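/- **Setting.** Let $l\ge 3$. On $\mathbb R^{2,l-1}$, with coordinates $(u,t,x_1,\dots,x_{l-1})$, take the form $u^2+t^2-x_1^2-\dots-x_{l-1}^2$. Let $G_l=SO_0(2,l-1)$ be the identity component of its special isometry group, let $H_l=SO_0(1,l-1)$ be the stabilizer of $e_u$ in $G_l$, and let $AdS_l=G_l/H_l$, with its quotient topology, the action of $G_l$ by left translations and the projection $g\mapsto[g]$. In $\mathfrak{so}(2,l-1)$ let * $J_1$ be the boost generator of the plane $(t,x_2)$, * $q_i$ be the boost generator of the plane $(u,x_i)$ ($1\le i\le l-1$), and $J_2=q_1$, * $q_0$ be the generator of the rotations of the plane $(u,t)$, $e_u\mapsto e_t\mapsto -e_u$. Let $\theta X=-X^{T}$ be the Cartan involution, $\mathfrak a=\langle J_1,J_2\rangle$, and let $\mathfrak n$ be the sum of the root spaces $\{X:[J_1,X]=\alpha X,\ [J_2,X]=\beta X\}$ for $(\alpha,\beta)\in\{(1,0),(0,1),(1,1),(1,-1)\}$. Let $A$, $N$, $\bar N$ be the subgroups of $G_l$ generated by the exponentials of the elements of $\mathfrak a$, $\mathfrak n$, $\theta\mathfrak n$,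 and let $AN$ and $A\bar N$ be the corresponding Iwasawa groups. * The *singularity* $\mathcal S_l\subset AdS_l$ is the set of the points whose $AN$-orbit or whose $A\bar N$-orbit is closed in $AdS_l$. * For $w\in S^{l-2}\subset\mathbb R^{l-1}$ put $E(w)=q_0+\sum_{i=1}^{l-1}w_iq_i$. The future light-like half-geodesics issued from $[g]$ are the curves $s\mapsto[g\,e^{sE(w)}]$, $s>0$. * The *black hole* $BH_l$ is the set of the points $v$ such that every future light-like half-geodesic issued from $v$ meets $\mathcal S_l$ (for some $s>0$). * The *free part* $\mathcal F_l$ is the set of the points from which at least one future light-like half-geodesic never meets $\mathcal S_l$ (for $s>0$). * The *horizon* $\mathscr H_l$ is the topological boundary of $BH_l$ in $AdS_l$. Let $\iota:AdS_l\to AdS_{l+1}$, $[g]\mapsto[\mathrm{diag}(g,1)]$, be the inclusion given by adding a last spacelike coordinate. **Theorem.** Let $l\ge 3$, let $X\in\mathfrak{so}(2,l)$ satisfy $[X,J_1]=0$, and let $R=\{e^{\alpha X}:\alpha\in\mathbb R\}$ be the one-parameter group generated by $X$. If $R\cdot\iota(AdS_l)=AdS_{l+1}$, then $$R\cdot\iota(\mathcal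 S_l)=\mathcal S_{l+1},\qquad R\cdot\iota(\mathcal F_l)=\mathcal F_{l+1},\qquad R\cdot\iota(BH_l)=BH_{l+1},\qquad R\cdot\iota(\mathscr H_l)=\mathscr H_{l+1}.$$ -/

import Mathlib

open scoped Pointwise

attribute [local instance 100] LieRing.ofAssociativeRing

namespace BTZ

noncomputable section

/-! Anti de Sitter space `AdS_l = SO₀(2,l-1)/SO₀(1,l-1)`, for `l ≥ 3`. Throughout, `l = k + 3`
with `k : ℕ`, so that `l - 1 = k + 2` is the number of spacelike coordinates.
The coordinates of `ℝ^{2,l-1}` are `u, t` (timelike, `Sum.inl 0` and `Sum.inl 1`) and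
`x₁, …, x_{l-1}` (spacelike, `x_i` is `Sum.inr (i-1)`). -/

/-- Index set of the coordinates `u, t, x₁, …, x_{k+2}` of `ℝ^{2,k+2}`. -/
abbrev Idx (k : ℕ) : Type := Fin 2 ⊕ Fin (k + 2)

/-- The Gram matrix `diag(1, 1, -1, …, -1)` of the standard form of signature `(2, k+2)`. -/
abbrev eta (k : ℕ) : Matrix (Idx k) (Idx k) ℝ :=
  LieAlgebra.Orthogonal.indefiniteDiagonal (Fin 2) (Fin (k + 2)) ℝ

/-- The Lie algebra `so(2, k+2)`. -/
abbrev so (k : ℕ) : LieSubalgebra ℝ (Matrix (Idx k) (Idx k) ℝ) :=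
  LieAlgebra.Orthogonal.so' (Fin 2) (Fin (k + 2)) ℝ

theorem mem_so_iff {k : ℕ} {X : Matrix (Idx k) (Idx k) ℝ} :
    X ∈ so k ↔ X.transpose * eta k = -(eta k * X) := by
  change X ∈ skewAdjointMatricesSubmodule (eta k) ↔ _
  rw [mem_skewAdjointMatricesSubmodule, Matrix.IsSkewAdjoint, Matrix.IsAdjointPair, mul_neg]

theorem eta_mul_eta (k : ℕ) : eta k * eta k = 1 := by
  rw [eta, LieAlgebra.Orthogonal.indefiniteDiagonal, Matrix.diagonal_mul_diagonal,
    ← Matrix.diagonal_one]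
  congr 1
  ext i
  rcases i with i | i <;> simp

theorem eta_transpose (k : ℕ) : (eta k).transpose = eta k := by
  rw [eta, LieAlgebra.Orthogonal.indefiniteDiagonal, Matrix.diagonal_transpose]

/-- The group `SO(2, k+2)`. -/
def SO2 (k : ℕ) : Subgroup (GL (Idx k) ℝ) where
  carrier := {g | (g : Matrix (Idx k) (Idx k) ℝ).transpose * eta k * g = eta k ∧
    (g : Matrix (Idx k) (Idx k) ℝ).det = 1}
  one_mem' := by simp
  mul_mem' := by
    rintro a b ⟨ha, ha'⟩ ⟨hb, hb'⟩
    refine ⟨?_, by simp [ha', hb']⟩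
    calc ((a * b : GL (Idx k) ℝ) : Matrix (Idx k) (Idx k) ℝ).transpose * eta k *
          ((a * b : GL (Idx k) ℝ) : Matrix (Idx k) (Idx k) ℝ)
        = (b : Matrix (Idx k) (Idx k) ℝ).transpose *
            ((a : Matrix (Idx k) (Idx k) ℝ).transpose * eta k * a) * b := by
          simp [Matrix.transpose_mul, Matrix.mul_assoc]
      _ = eta k := by rw [ha, hb]
  inv_mem' := by
    rintro a ⟨ha, ha'⟩
    have h1 : (a : Matrix (Idx k) (Idx k) ℝ) * ((a⁻¹ : GL (Idx k) ℝ) : Matrix _ _ ℝ) = 1 := by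
      rw [← Units.val_mul, mul_inv_cancel, Units.val_one]
    refine ⟨?_, ?_⟩
    · have h2 : ((a⁻¹ : GL (Idx k) ℝ) : Matrix (Idx k) (Idx k) ℝ).transpose *
          (a : Matrix (Idx k) (Idx k) ℝ).transpose = 1 := by
        rw [← Matrix.transpose_mul, h1, Matrix.transpose_one]
      calc ((a⁻¹ : GL (Idx k) ℝ) : Matrix (Idx k) (Idx k) ℝ).transpose * eta k *
            ((a⁻¹ : GL (Idx k) ℝ) : Matrix (Idx k) (Idx k) ℝ)
          = (((a⁻¹ : GL (Idx k) ℝ) : Matrix (Idx k) (Idx k) ℝ).transpose *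
              (a : Matrix (Idx k) (Idx k) ℝ).transpose) * eta k *
              ((a : Matrix (Idx k) (Idx k) ℝ) * ((a⁻¹ : GL (Idx k) ℝ) : Matrix _ _ ℝ)) := by
            conv_lhs => rw [← ha]
            simp only [Matrix.mul_assoc]
        _ = eta k := by rw [h1, h2, one_mul, mul_one]
    · have h3 := congrArg Matrix.det h1
      rwa [Matrix.det_mul, ha', one_mul, Matrix.det_one] at h3

/-- The group `G_l = SO₀(2, l-1)` with `l = k + 3`: the identity component of `SO(2, l-1)`. -/
def G (k : ℕ) : Subgroup (GL (Idx k) ℝ) :=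
  (Subgroup.connectedComponentOfOne (SO2 k)).map (SO2 k).subtype

/-- The matrix of an element of `G k`. -/
abbrev mat {k : ℕ} (g : G k) : Matrix (Idx k) (Idx k) ℝ :=
  ((g : GL (Idx k) ℝ) : Matrix (Idx k) (Idx k) ℝ)

/-- The base vector `e_u` of the hyperboloid `u² + t² - x₁² - … = 1`. -/
def baseVec (k : ℕ) : Idx k → ℝ := Pi.single (Sum.inl 0) 1

/-- The group `H_l = SO₀(1, l-1)`: the elements of `SO₀(2, l-1)` which fix `e_u`. -/
def H (k : ℕ) : Subgroup (G k) where
  carrier := {g | (mat g).mulVec (baseVec k) = baseVec k}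
  one_mem' := by simp [mat]
  mul_mem' := by
    rintro a b ha hb
    simp only [Set.mem_ofPred_eq, mat] at ha hb ⊢
    rw [Subgroup.coe_mul, Units.val_mul, ← Matrix.mulVec_mulVec, hb, ha]
  inv_mem' := by
    rintro a ha
    simp only [Set.mem_ofPred_eq, mat] at ha ⊢
    conv_lhs => rw [← ha]
    rw [Matrix.mulVec_mulVec, ← Units.val_mul, Subgroup.coe_inv, inv_mul_cancel, Units.val_one,
      Matrix.one_mulVec]

/-- Anti de Sitter space `AdS_l = G_l / H_l` with `l = k + 3`, with its quotient topology and the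
left action of `G_l`. -/
abbrev AdS (k : ℕ) : Type := G k ⧸ H k

/-- The projection `π : G_l → AdS_l`, `g ↦ [g]`. -/
abbrev proj {k : ℕ} (g : G k) : AdS k := (g : G k ⧸ H k)

/-! ### The exponential map `so(2, l-1) → SO₀(2, l-1)` -/

/-- `exp X`, as an invertible matrix. -/
def expGL {k : ℕ} (X : Matrix (Idx k) (Idx k) ℝ) : GL (Idx k) ℝ where
  val := NormedSpace.exp X
  inv := NormedSpace.exp (-X)
  val_inv := by
    rw [← Matrix.exp_add_of_commute _ _ (Commute.neg_right (Commute.refl X)), add_neg_cancel,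
      NormedSpace.exp_zero]
  inv_val := by
    rw [← Matrix.exp_add_of_commute _ _ (Commute.neg_left (Commute.refl X)), neg_add_cancel,
      NormedSpace.exp_zero]

theorem continuous_matrix_exp (k : ℕ) :
    Continuous (NormedSpace.exp : Matrix (Idx k) (Idx k) ℝ → Matrix (Idx k) (Idx k) ℝ) := by
  let _ : NormedRing (Matrix (Idx k) (Idx k) ℝ) := Matrix.linftyOpNormedRing
  let _ : NormedAlgebra ℝ (Matrix (Idx k) (Idx k) ℝ) := Matrix.linftyOpNormedAlgebra
  let _ : NormedAlgebra ℚ (Matrix (Idx k) (Idx k) ℝ) :=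
    NormedAlgebra.restrictScalars ℚ ℝ (Matrix (Idx k) (Idx k) ℝ)
  exact NormedSpace.exp_continuous

theorem continuous_expGL (k : ℕ) :
    Continuous (expGL : Matrix (Idx k) (Idx k) ℝ → GL (Idx k) ℝ) := by
  rw [Units.continuous_iff]
  exact ⟨continuous_matrix_exp k, (continuous_matrix_exp k).comp continuous_neg⟩

theorem exp_form {k : ℕ} {X : Matrix (Idx k) (Idx k) ℝ} (hX : X ∈ so k) :
    (NormedSpace.exp X).transpose * eta k * NormedSpace.exp X = eta k := by
  have h1 : X.transpose = eta k * (-X) * (eta k)⁻¹ := by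
    have h := mem_so_iff.1 hX
    rw [Matrix.inv_eq_left_inv (eta_mul_eta k), mul_neg, ← h, Matrix.mul_assoc, eta_mul_eta,
      mul_one]
  have hu : IsUnit (eta k) := ⟨⟨eta k, eta k, eta_mul_eta k, eta_mul_eta k⟩, rfl⟩
  rw [← Matrix.exp_transpose, h1, Matrix.exp_conj _ _ hu,
    Matrix.inv_eq_left_inv (eta_mul_eta k)]
  calc eta k * NormedSpace.exp (-X) * eta k * eta k * NormedSpace.exp X
      = eta k * NormedSpace.exp (-X) * (eta k * eta k) * NormedSpace.exp X := by
        simp only [Matrix.mul_assoc]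
    _ = eta k * (NormedSpace.exp (-X) * NormedSpace.exp X) := by
        rw [eta_mul_eta, mul_one, Matrix.mul_assoc]
    _ = eta k := by
        rw [← Matrix.exp_add_of_commute _ _ (Commute.neg_left (Commute.refl X)), neg_add_cancel,
          NormedSpace.exp_zero, mul_one]

theorem exp_det {k : ℕ} {X : Matrix (Idx k) (Idx k) ℝ} (hX : X ∈ so k) :
    (NormedSpace.exp X).det = 1 := by
  have hY : (1 / 2 : ℝ) • X ∈ so k := (so k).smul_mem _ hX
  have h := congrArg Matrix.det (exp_form hY)
  have he : (eta k).det ≠ 0 := by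
    have h2 := congrArg Matrix.det (eta_mul_eta k)
    rw [Matrix.det_mul, Matrix.det_one] at h2
    exact left_ne_zero_of_mul_eq_one h2
  rw [Matrix.det_mul, Matrix.det_mul, Matrix.det_transpose] at h
  have h3 : X = (1 / 2 : ℝ) • X + (1 / 2 : ℝ) • X := by
    rw [← add_smul]; norm_num
  rw [h3, Matrix.exp_add_of_commute _ _ (Commute.refl _), Matrix.det_mul]
  refine mul_right_cancel₀ he ?_
  rw [one_mul]
  linarith

theorem expGL_mem_SO2 {k : ℕ} {X : Matrix (Idx k) (Idx k) ℝ} (hX : X ∈ so k) :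
    expGL X ∈ SO2 k :=
  ⟨exp_form hX, exp_det hX⟩

theorem expGL_mem_G {k : ℕ} {X : Matrix (Idx k) (Idx k) ℝ} (hX : X ∈ so k) :
    expGL X ∈ G k := by
  let f : ℝ → SO2 k := fun s => ⟨expGL (s • X), expGL_mem_SO2 ((so k).smul_mem s hX)⟩
  have hf : Continuous f :=
    ((continuous_expGL k).comp (continuous_id.smul continuous_const)).subtype_mk _
  have h0 : f 0 = 1 := by
    apply Subtype.ext
    apply Units.ext
    simp [f, expGL]
  refine ⟨f 1, ?_, by simp [f]⟩
  have h := (isPreconnected_range hf).subset_connectedComponent ⟨0, h0⟩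
  exact h ⟨1, rfl⟩

/-- The exponential map `so(2, l-1) → SO₀(2, l-1)`. -/
def expG {k : ℕ} (X : so k) : G k := ⟨expGL (X : Matrix (Idx k) (Idx k) ℝ), expGL_mem_G X.2⟩

/-! ### Elements and subspaces of `so(2, l-1)` -/

/-- The generator of the boosts in the plane of the `a`-th timelike and the `i`-th spacelike
coordinate. -/
def boost {k : ℕ} (a : Fin 2) (i : Fin (k + 2)) : so k :=
  ⟨Matrix.single (Sum.inl a) (Sum.inr i) 1 + Matrix.single (Sum.inr i) (Sum.inl a) 1, by
    rw [mem_so_iff, eta, LieAlgebra.Orthogonal.indefiniteDiagonal]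
    ext x y
    rcases x with x | x <;> rcases y with y | y <;>
      simp [Matrix.mul_diagonal, Matrix.diagonal_mul, Matrix.single_apply, and_comm, neg_ite]⟩

/-- `J₁`, the boost in the plane `(t, x₂)`; it belongs to the Lie algebra of `H`. -/
def J1 (k : ℕ) : so k := boost 1 1

/-- `J₂ = q₁`, the boost in the plane `(u, x₁)`. -/
def J2 (k : ℕ) : so k := boost 0 0

/-- `q₀`, the rotation `e_u ↦ e_t`, `e_t ↦ -e_u` in the timelike plane, which generates the factor
`SO(2)` of the maximal compact subgroup `SO(2) × SO(l-1)`. -/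
def q0 (k : ℕ) : so k :=
  ⟨Matrix.single (Sum.inl 1) (Sum.inl 0) 1 - Matrix.single (Sum.inl 0) (Sum.inl 1) 1, by
    rw [mem_so_iff, eta, LieAlgebra.Orthogonal.indefiniteDiagonal]
    ext x y
    rcases x with x | x <;> rcases y with y | y <;>
      simp [Matrix.mul_diagonal, Matrix.diagonal_mul, Matrix.single_apply, and_comm]⟩

/-- The Cartan involution `θ X = -Xᵀ`. -/
def theta (k : ℕ) : so k →ₗ[ℝ] so k where
  toFun X := ⟨-(X : Matrix (Idx k) (Idx k) ℝ).transpose, by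
    have h := mem_so_iff.1 X.2
    rw [mem_so_iff, Matrix.transpose_neg, Matrix.transpose_transpose, neg_mul, mul_neg, neg_neg]
    have h1 := congrArg (fun M => eta k * M * eta k) h
    simp only [mul_neg, neg_mul] at h1
    rw [Matrix.mul_assoc, Matrix.mul_assoc, eta_mul_eta, mul_one, ← Matrix.mul_assoc (eta k),
      eta_mul_eta, one_mul] at h1
    rw [h1]⟩
  map_add' X Y := Subtype.ext (by
    change -(X.1 + Y.1).transpose = -X.1.transpose + -Y.1.transpose
    rw [Matrix.transpose_add, neg_add])
  map_smul' c X := Subtype.ext (by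
    change -(c • X.1).transpose = c • -X.1.transpose
    rw [Matrix.transpose_smul, smul_neg])

/-- The Cartan subspace `𝔞 = ⟨J₁, J₂⟩`. -/
def cartan (k : ℕ) : Submodule ℝ (so k) := Submodule.span ℝ {J1 k, J2 k}

/-- The common eigenspace `{X : [J₁, X] = α X, [J₂, X] = β X}`. -/
def rootSpace (k : ℕ) (α β : ℝ) : Submodule ℝ (so k) where
  carrier := {X | ⁅J1 k, X⁆ = α • X ∧ ⁅J2 k, X⁆ = β • X}
  zero_mem' := by simp
  add_mem' := by
    rintro X Y ⟨h1, h2⟩ ⟨h3, h4⟩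
    exact ⟨by rw [lie_add, h1, h3, smul_add], by rw [lie_add, h2, h4, smul_add]⟩
  smul_mem' := by
    rintro c X ⟨h1, h2⟩
    exact ⟨by rw [lie_smul, h1, smul_comm], by rw [lie_smul, h2, smul_comm]⟩

/-- The nilpotent Iwasawa component `𝔫 = ⟨X_{+0}, X_{0+}, X_{++}, X_{+-}⟩`. -/
def nilp (k : ℕ) : Submodule ℝ (so k) :=
  rootSpace k 1 0 ⊔ rootSpace k 0 1 ⊔ rootSpace k 1 1 ⊔ rootSpace k 1 (-1)

/-- The opposite nilpotent component `θ 𝔫`. -/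
def nilpBar (k : ℕ) : Submodule ℝ (so k) := (nilp k).map (theta k)

/-- The subgroup of `SO₀(2, l-1)` generated by the exponentials of the elements of `V`. -/
def expSubgroup {k : ℕ} (V : Submodule ℝ (so k)) : Subgroup (G k) :=
  Subgroup.closure (expG '' (V : Set (so k)))

/-- The Iwasawa group `AN`. -/
def AN (k : ℕ) : Subgroup (G k) := expSubgroup (cartan k) ⊔ expSubgroup (nilp k)

/-- The opposite Iwasawa group `A N̄`. -/
def ANbar (k : ℕ) : Subgroup (G k) := expSubgroup (cartan k) ⊔ expSubgroup (nilpBar k)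

/-! ### The causal structure -/

/-- The singularity `S_l`: the points of the closed orbits of `AN` and of `A N̄` in `AdS_l`. -/
def Singularity (k : ℕ) : Set (AdS k) :=
  {v | IsClosed (MulAction.orbit (AN k) v) ∨ IsClosed (MulAction.orbit (ANbar k) v)}

/-- The element `E(w) = q₀ + ∑ w_i q_i` of the tangent space of `AdS_l` at the base point. For `w`
in the unit sphere `S^{l-2}` these are the future directed light-like directions. -/
def direction {k : ℕ} (w : Fin (k + 2) → ℝ) : so k := q0 k + ∑ i, w i • boost 0 i

/-- The geodesic `s ↦ π(g e^{sE(w)})`. -/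
def geodesic {k : ℕ} (g : G k) (w : Fin (k + 2) → ℝ) (s : ℝ) : AdS k :=
  proj (g * expG (s • direction w))

/-- The black hole `BH_l`: the points such that all light-like geodesics issued from them intersect
the singularity in the future, i.e. for some `s > 0`. -/
def BlackHole (k : ℕ) : Set (AdS k) :=
  {v | ∀ g : G k, proj g = v → ∀ w : Fin (k + 2) → ℝ, ∑ i, w i ^ 2 = 1 →
    ∃ s : ℝ, 0 < s ∧ geodesic g w s ∈ Singularity k}

/-- The free part `F_l`: the points from which some light-like direction escapes the singularity in
the future. -/
def FreePart (k : ℕ) : Set (AdS k) :=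
  {v | ∃ g : G k, proj g = v ∧ ∃ w : Fin (k + 2) → ℝ, ∑ i, w i ^ 2 = 1 ∧
    ∀ s : ℝ, 0 < s → geodesic g w s ∉ Singularity k}

/-- The horizon: the boundary of the black hole. -/
def Horizon (k : ℕ) : Set (AdS k) := frontier (BlackHole k)

/-! ### The inclusion `ι : AdS_l → AdS_{l+1}` -/

/-- The coordinates of `ℝ^{2,l}` are those of `ℝ^{2,l-1}` and one last spacelike coordinate. -/
def idxEquiv (k : ℕ) : Idx k ⊕ Fin 1 ≃ Idx (k + 1) :=
  (Equiv.sumAssoc (Fin 2) (Fin (k + 2)) (Fin 1)).trans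
    (Equiv.sumCongr (Equiv.refl (Fin 2)) finSumFinEquiv)

/-- The block inclusion `M ↦ diag(M, 1)`. -/
def blockIncl (k : ℕ) :
    Matrix (Idx k) (Idx k) ℝ →* Matrix (Idx (k + 1)) (Idx (k + 1)) ℝ where
  toFun M := Matrix.reindex (idxEquiv k) (idxEquiv k) (Matrix.fromBlocks M 0 0 1)
  map_one' := by simp
  map_mul' M N := by
    simp only [Matrix.reindex_apply, Matrix.submatrix_mul_equiv, Matrix.fromBlocks_multiply]
    simp

theorem blockIncl_eta (k : ℕ) (M : Matrix (Idx k) (Idx k) ℝ)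
    (h : M.transpose * eta k * M = eta k) :
    (blockIncl k M).transpose * eta (k + 1) * blockIncl k M = eta (k + 1) := by
  have he : eta (k + 1) = Matrix.reindex (idxEquiv k) (idxEquiv k)
      (Matrix.fromBlocks (eta k) 0 0 (-1)) := by
    rw [eta, eta, LieAlgebra.Orthogonal.indefiniteDiagonal,
      LieAlgebra.Orthogonal.indefiniteDiagonal, ← Matrix.diagonal_one, Matrix.diagonal_neg,
      Matrix.fromBlocks_diagonal, Matrix.reindex_apply, Matrix.submatrix_diagonal_equiv]
    congr 1
    ext x
    obtain ⟨y, rfl⟩ := (idxEquiv k).surjective x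
    rcases y with (y | y) | y <;> simp [idxEquiv]
  rw [he]
  simp only [blockIncl, MonoidHom.coe_mk, OneHom.coe_mk, Matrix.reindex_apply,
    Matrix.transpose_submatrix, Matrix.submatrix_mul_equiv, Matrix.fromBlocks_transpose,
    Matrix.fromBlocks_multiply]
  simp [h]

theorem blockIncl_det (k : ℕ) (M : Matrix (Idx k) (Idx k) ℝ) :
    (blockIncl k M).det = M.det := by
  simp [blockIncl]

theorem continuous_blockIncl (k : ℕ) : Continuous (blockIncl k) := by
  have h : Continuous fun M : Matrix (Idx k) (Idx k) ℝ =>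
      Matrix.fromBlocks M 0 0 (1 : Matrix (Fin 1) (Fin 1) ℝ) :=
    Continuous.matrix_fromBlocks continuous_id continuous_const continuous_const continuous_const
  exact h.matrix_submatrix _ _

theorem map_blockIncl_mem_SO2 {k : ℕ} {g : GL (Idx k) ℝ} (hg : g ∈ SO2 k) :
    Units.map (blockIncl k) g ∈ SO2 (k + 1) :=
  ⟨blockIncl_eta k _ hg.1, (blockIncl_det k _).trans hg.2⟩

theorem map_blockIncl_mem_G {k : ℕ} {g : GL (Idx k) ℝ} (hg : g ∈ G k) :
    Units.map (blockIncl k) g ∈ G (k + 1) := by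
  obtain ⟨x, hx, rfl⟩ := hg
  let f : SO2 k → SO2 (k + 1) := fun x => ⟨Units.map (blockIncl k) x, map_blockIncl_mem_SO2 x.2⟩
  have hf : Continuous f :=
    ((Continuous.units_map (blockIncl k) (continuous_blockIncl k)).comp
      continuous_subtype_val).subtype_mk _
  have h1 : f 1 = 1 := Subtype.ext (map_one (Units.map (blockIncl k)))
  refine ⟨f x, ?_, rfl⟩
  have h := hf.image_connectedComponent_subset 1 ⟨x, hx, rfl⟩
  rwa [h1] at h

/-- The block inclusion `SO₀(2, l-1) → SO₀(2, l)`. -/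
def inclG (k : ℕ) : G k →* G (k + 1) :=
  ((Units.map (blockIncl k)).comp (G k).subtype).codRestrict (G (k + 1))
    fun g => map_blockIncl_mem_G g.2

theorem inclG_mem_H {k : ℕ} {h : G k} (hh : h ∈ H k) : inclG k h ∈ H (k + 1) := by
  have hh' : (mat h).mulVec (baseVec k) = baseVec k := hh
  change (blockIncl k (mat h)).mulVec (baseVec (k + 1)) = baseVec (k + 1)
  have hb : baseVec (k + 1) = Sum.elim (baseVec k) 0 ∘ (idxEquiv k).symm := by
    ext x
    obtain ⟨y, rfl⟩ := (idxEquiv k).surjective x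
    rcases y with (y | y) | y <;> simp [idxEquiv, baseVec, Pi.single_apply]
  rw [hb]
  change ((Matrix.fromBlocks (mat h) 0 0 1).submatrix (idxEquiv k).symm
    (idxEquiv k).symm).mulVec _ = _
  rw [Matrix.submatrix_mulVec_equiv]
  simp [Function.comp_assoc, Matrix.fromBlocks_mulVec, hh']

/-- The inclusion `ι : AdS_l → AdS_{l+1}`, `[g] ↦ [diag(g, 1)]`. -/
def incl (k : ℕ) : AdS k → AdS (k + 1) :=
  Quotient.map' (inclG k) fun a b hab => by
    rw [QuotientGroup.leftRel_apply] at hab ⊢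
    rw [← map_inv, ← map_mul]
    exact inclG_mem_H hab

/-- The one-parameter group `R = {e^{αX} : α ∈ ℝ}` generated by `X`. -/
def oneParam {k : ℕ} (X : so k) : Set (G k) := Set.range fun α : ℝ => expG (α • X)

end

end BTZ

/-! The map $[g]\mapsto g e_u$ embeds $AdS_l$ in the quadric $u^2+t^2-\sum x_i^2=1$, and all four
sets turn out to be cut out there by conditions on $u,t,x_2$ alone, the same for every $l$.

An $AN$-orbit is closed exactly when it lies in the hyperplane orthogonal to the null vector
$e_t+e_{x_2}$, and an $A\bar N$-orbit when it lies in that of $e_t-e_{x_2}$ (`isClosed_orbit_iff`).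
So the singularity is $t^2=x_2^2$ (`mem_Singularity_iff`). Light-like geodesics are straight lines
$v+s\xi$, with $\xi$ null and tangent at $v$, and the future is read off from the sign of
$u\xi_t-t\xi_u$ (`mem_BlackHole_iff_forall`). Cauchy-Schwarz on one side and explicit escaping rays
on the other identify the black hole with $0<t^2-x_2^2<1$, $ut<0$ (`mem_BlackHole_iff`). Its closure
is given by the weak inequalities (`mem_closure_BlackHole_of_ClosedRegion`), and the free part is
the complement of the black hole.

Hence each set in $AdS_l$ is the preimage under $\iota$ of its analogue in $AdS_{l+1}$. Each is also
$R$-invariant: an $X$ commuting with $J_1$ preserves the eigenlines of $e_t\pm e_{x_2}$, hence the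
singularity, and left translations carry geodesics to geodesics and are homeomorphisms. Since $R$
moves every point of $AdS_{l+1}$ from $\iota(AdS_l)$, the four equalities follow
(`oneParam_smul_image_incl`). -/

namespace BTZ

open Matrix

/-! ### The quadratic form and the exponentials of some elements -/

/-- The standard bilinear form of signature `(2, k+2)`. -/
def form {k : ℕ} (v w : Idx k → ℝ) : ℝ := v ⬝ᵥ (eta k *ᵥ w)

theorem eta_mulVec_inl {k : ℕ} (w : Idx k → ℝ) (i : Fin 2) :
    (eta k *ᵥ w) (Sum.inl i) = w (Sum.inl i) := by
  simp [eta, LieAlgebra.Orthogonal.indefiniteDiagonal, Matrix.mulVec_diagonal]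

theorem eta_mulVec_inr {k : ℕ} (w : Idx k → ℝ) (i : Fin (k + 2)) :
    (eta k *ᵥ w) (Sum.inr i) = -w (Sum.inr i) := by
  simp [eta, LieAlgebra.Orthogonal.indefiniteDiagonal, Matrix.mulVec_diagonal]

theorem form_apply {k : ℕ} (v w : Idx k → ℝ) :
    form v w = v (Sum.inl 0) * w (Sum.inl 0) + v (Sum.inl 1) * w (Sum.inl 1)
      - v (Sum.inr 0) * w (Sum.inr 0) - v (Sum.inr 1) * w (Sum.inr 1)
      - ∑ i : Fin k, v (Sum.inr i.succ.succ) * w (Sum.inr i.succ.succ) := by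
  rw [form, dotProduct, Fintype.sum_sum_type]
  simp only [eta_mulVec_inl, eta_mulVec_inr, Fin.sum_univ_two, Fin.sum_univ_succ (n := k + 1),
    Fin.sum_univ_succ (n := k), mul_neg, Finset.sum_neg_distrib]
  simp only [Fin.succ_zero_eq_one]
  ring

theorem form_comm {k : ℕ} (v w : Idx k → ℝ) : form v w = form w v := by
  simp only [form_apply, mul_comm]

theorem form_add_right {k : ℕ} (v w z : Idx k → ℝ) : form v (w + z) = form v w + form v z := by
  simp [form, mulVec_add]

theorem form_sub_right {k : ℕ} (v w z : Idx k → ℝ) : form v (w - z) = form v w - form v z := by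
  simp [form, mulVec_sub]

theorem form_smul_right {k : ℕ} (c : ℝ) (v w : Idx k → ℝ) : form v (c • w) = c * form v w := by
  simp [form, mulVec_smul]

theorem form_add_left {k : ℕ} (v w z : Idx k → ℝ) : form (v + w) z = form v z + form w z := by
  simp [form]

theorem form_sub_left {k : ℕ} (v w z : Idx k → ℝ) : form (v - w) z = form v z - form w z := by
  simp [form]

theorem form_smul_left {k : ℕ} (c : ℝ) (v w : Idx k → ℝ) : form (c • v) w = c * form v w := by
  simp [form]

theorem form_mulVec {k : ℕ} (g : G k) (v w : Idx k → ℝ) :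
    form (mat g *ᵥ v) (mat g *ᵥ w) = form v w := by
  have h : (mat g).transpose * eta k * mat g = eta k := by
    obtain ⟨x, _, hx⟩ := g.2
    rw [mat, ← hx]
    exact x.2.1
  rw [form, form, mulVec_mulVec, dotProduct_mulVec, vecMul_mulVec, ← mul_assoc, h,
    ← dotProduct_mulVec]

theorem mat_mul {k : ℕ} (g h : G k) : mat (g * h) = mat g * mat h := rfl

theorem mat_one {k : ℕ} : mat (1 : G k) = 1 := rfl

theorem mat_inv_mulVec_mulVec {k : ℕ} (g : G k) (v : Idx k → ℝ) :
    mat g⁻¹ *ᵥ (mat g *ᵥ v) = v := by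
  rw [mulVec_mulVec, ← mat_mul, inv_mul_cancel, mat_one, one_mulVec]

theorem mat_mulVec_inv_mulVec {k : ℕ} (g : G k) (v : Idx k → ℝ) :
    mat g *ᵥ (mat g⁻¹ *ᵥ v) = v := by
  rw [mulVec_mulVec, ← mat_mul, mul_inv_cancel, mat_one, one_mulVec]

theorem form_mulVec_right {k : ℕ} (g : G k) (v w : Idx k → ℝ) :
    form v (mat g *ᵥ w) = form (mat g⁻¹ *ᵥ v) w := by
  rw [← form_mulVec g (mat g⁻¹ *ᵥ v), mat_mulVec_inv_mulVec]

theorem form_so_mulVec {k : ℕ} (X : so k) (v w : Idx k → ℝ) :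
    form (X.1 *ᵥ v) w = -form v (X.1 *ᵥ w) := by
  rw [form, form, dotProduct_mulVec, vecMul_mulVec, mem_so_iff.1 X.2, mulVec_mulVec,
    ← dotProduct_mulVec, neg_mulVec, dotProduct_neg]

theorem so_ext {k : ℕ} {X Y : so k} (h : ∀ v, X.1 *ᵥ v = Y.1 *ᵥ v) : X = Y :=
  Subtype.ext (Matrix.ext_of_mulVec_single fun _ => h _)

theorem so_coe_add {k : ℕ} (X Y : so k) : (X + Y).1 = X.1 + Y.1 := rfl

theorem so_coe_smul {k : ℕ} (c : ℝ) (X : so k) : (c • X).1 = c • X.1 := rfl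

theorem lie_mulVec {k : ℕ} (X Y : so k) (v : Idx k → ℝ) :
    (⁅X, Y⁆ : so k).1 *ᵥ v = X.1 *ᵥ (Y.1 *ᵥ v) - Y.1 *ᵥ (X.1 *ᵥ v) := by
  rw [LieSubalgebra.coe_bracket, Ring.lie_def, sub_mulVec, mulVec_mulVec, mulVec_mulVec]

/-- The element `z ↦ ⟨x, z⟩ y - ⟨y, z⟩ x` of `so(2, k+2)`. -/
def wedge {k : ℕ} (x y : Idx k → ℝ) : so k :=
  ⟨vecMulVec y (eta k *ᵥ x) - vecMulVec x (eta k *ᵥ y), by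
    rw [mem_so_iff, transpose_sub, transpose_vecMulVec, transpose_vecMulVec, sub_mul, mul_sub,
      vecMulVec_mul, vecMulVec_mul, mul_vecMulVec, mul_vecMulVec, ← mulVec_transpose,
      ← mulVec_transpose, eta_transpose, neg_sub]⟩

theorem wedge_mulVec {k : ℕ} (x y z : Idx k → ℝ) :
    (wedge x y).1 *ᵥ z = form x z • y - form y z • x := by
  rw [wedge, sub_mulVec, vecMulVec_mulVec, vecMulVec_mulVec, form_comm x, form_comm y, form, form,
    dotProduct_comm z, dotProduct_comm z]
  ext i
  simp

theorem lie_wedge {k : ℕ} (Z : so k) (x y : Idx k → ℝ) :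
    ⁅Z, wedge x y⁆ = wedge (Z.1 *ᵥ x) y + wedge x (Z.1 *ᵥ y) := by
  refine so_ext fun v => ?_
  rw [lie_mulVec, so_coe_add, add_mulVec]
  simp only [wedge_mulVec, form_so_mulVec, mulVec_sub, mulVec_smul]
  module

theorem wedge_add_right {k : ℕ} (x y z : Idx k → ℝ) :
    wedge x (y + z) = wedge x y + wedge x z := by
  refine so_ext fun v => ?_
  rw [so_coe_add, add_mulVec]
  simp only [wedge_mulVec, form_add_left]
  module

theorem wedge_smul_right {k : ℕ} (c : ℝ) (x y : Idx k → ℝ) :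
    wedge x (c • y) = c • wedge x y := by
  refine so_ext fun v => ?_
  rw [so_coe_smul, smul_mulVec]
  simp only [wedge_mulVec, form_smul_left]
  module

theorem wedge_smul_left {k : ℕ} (c : ℝ) (x y : Idx k → ℝ) :
    wedge (c • x) y = c • wedge x y := by
  refine so_ext fun v => ?_
  rw [so_coe_smul, smul_mulVec]
  simp only [wedge_mulVec, form_smul_left]
  module

theorem wedge_self {k : ℕ} (x : Idx k → ℝ) : wedge x x = 0 := by
  refine so_ext fun v => ?_
  simp [wedge_mulVec]

/-! ### Matrix exponentials applied to vectors. -/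

theorem hasSum_exp_mulVec {k : ℕ} (M : Matrix (Idx k) (Idx k) ℝ) (z : Idx k → ℝ) :
    HasSum (fun n : ℕ => ((n.factorial : ℝ)⁻¹) • (M ^ n *ᵥ z)) (NormedSpace.exp M *ᵥ z) := by
  let _ : NormedRing (Matrix (Idx k) (Idx k) ℝ) := Matrix.linftyOpNormedRing
  let _ : NormedAlgebra ℝ (Matrix (Idx k) (Idx k) ℝ) := Matrix.linftyOpNormedAlgebra
  let _ : NormedAlgebra ℚ (Matrix (Idx k) (Idx k) ℝ) :=
    NormedAlgebra.restrictScalars ℚ ℝ (Matrix (Idx k) (Idx k) ℝ)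
  have h := NormedSpace.exp_series_hasSum_exp' (𝕂 := ℝ) M
  have h2 := h.map (AddMonoidHom.mk' (fun N : Matrix (Idx k) (Idx k) ℝ => N *ᵥ z)
    fun a b => add_mulVec a b z) (continuous_id.matrix_mulVec continuous_const)
  have h3 : (fun n : ℕ => ((n.factorial : ℝ)⁻¹) • (M ^ n *ᵥ z)) =
      fun n : ℕ => (((n.factorial : ℝ)⁻¹) • M ^ n) *ᵥ z :=
    funext fun n => (smul_mulVec _ _ _).symm
  rw [h3]
  exact h2

theorem mat_expG {k : ℕ} (X : so k) : mat (expG X) = NormedSpace.exp X.1 := rfl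

theorem exp_mulVec_of_eigen {k : ℕ} {M : Matrix (Idx k) (Idx k) ℝ} {z : Idx k → ℝ} {c : ℝ}
    (h : M *ᵥ z = c • z) : NormedSpace.exp M *ᵥ z = Real.exp c • z := by
  have hp : ∀ n : ℕ, M ^ n *ᵥ z = c ^ n • z := by
    intro n
    induction n with
    | zero => simp
    | succ n ih => rw [pow_succ, ← mulVec_mulVec, h, mulVec_smul, ih, smul_smul, pow_succ, mul_comm]
  refine (hasSum_exp_mulVec M z).unique ?_
  have h2 := (NormedSpace.exp_series_hasSum_exp' (𝕂 := ℝ) c).smul_const z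
  rw [← Real.exp_eq_exp_ℝ] at h2
  simpa only [hp, smul_smul, smul_eq_mul] using h2

theorem exp_mulVec_of_cube_zero {k : ℕ} {M : Matrix (Idx k) (Idx k) ℝ} {z : Idx k → ℝ}
    (h : M *ᵥ (M *ᵥ (M *ᵥ z)) = 0) :
    NormedSpace.exp M *ᵥ z = z + M *ᵥ z + (1 / 2 : ℝ) • (M *ᵥ (M *ᵥ z)) := by
  refine (hasSum_exp_mulVec M z).unique ?_
  have h3 : M ^ 3 *ᵥ z = 0 := by
    rw [pow_succ, pow_two, mul_assoc, ← mulVec_mulVec, ← mulVec_mulVec, h]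
  have hs := hasSum_sum_of_ne_finset_zero (s := Finset.range 3) (L := .unconditional ℕ)
    (f := fun n : ℕ => ((n.factorial : ℝ)⁻¹) • (M ^ n *ᵥ z)) fun n hn => by
      obtain ⟨m, rfl⟩ := Nat.exists_eq_add_of_le' (not_lt.1 (Finset.mem_range.not.1 hn))
      rw [pow_add, ← mulVec_mulVec, h3, mulVec_zero, smul_zero]
  convert hs using 1
  simp [Finset.sum_range_succ, pow_two, mulVec_mulVec, Nat.factorial]

/-- The operator $M=l\wedge w$ kills $l$ and sends $w$ to a multiple of $l$, so $M^3=0$ and the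
exponential series stops at degree two. Unipotent elements and light rays alike are computed from
this formula. -/
theorem exp_wedge_mulVec {k : ℕ} {l w : Idx k → ℝ} (hl : form l l = 0) (hw : form l w = 0)
    (z : Idx k → ℝ) :
    mat (expG (wedge l w)) *ᵥ z =
      z + form l z • w - form w z • l - (form l z * form w w / 2) • l := by
  have hw' : form w l = 0 := by rw [form_comm, hw]
  rw [mat_expG, exp_mulVec_of_cube_zero]
  · simp only [wedge_mulVec, form_sub_right, form_smul_right, hl, hw, hw']
    module
  · simp only [wedge_mulVec, form_sub_right, form_smul_right, hl, hw, hw']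
    module

/-- For `l` null, a suitable exponential `exp (l ∧ w)` maps `v` to `v'` when both are unit vectors
with the same non-zero product with `l`. -/
theorem exp_wedge_transport {k : ℕ} {l v v' : Idx k → ℝ} (hl : form l l = 0)
    (hv : form v v = 1) (hv' : form v' v' = 1) (h0 : form l v ≠ 0) (h : form l v' = form l v) :
    mat (expG (wedge l ((form l v)⁻¹ • (v' - v)))) *ᵥ v = v' := by
  rw [exp_wedge_mulVec hl (by rw [form_smul_right, form_sub_right, h, sub_self, mul_zero])]
  simp only [form_smul_left, form_smul_right, form_sub_left, form_sub_right, hv, hv',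
    form_comm v v']
  rw [smul_smul, mul_inv_cancel₀ h0, one_smul]
  -- The quadratic term along $l$ cancels the linear one because $v$ and $v'$ have the same norm.
  have : (form l v * ((form l v)⁻¹ * ((form l v)⁻¹ * (1 - form v' v) - (form l v)⁻¹ *
      (form v' v - 1))) / 2) = -((form l v)⁻¹ * (form v' v - 1)) := by
    field_simp
    ring
  rw [this]
  module

/-! ### Points of anti de Sitter space as vectors -/

/-- The point `g e_u` of the hyperboloid which corresponds to `[g]`. -/
def pt {k : ℕ} : AdS k → Idx k → ℝ :=
  Quotient.lift (fun g : G k => mat g *ᵥ baseVec k) fun a b hab => by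
    have h : a⁻¹ * b ∈ H k := QuotientGroup.leftRel_apply.1 hab
    have h2 : mat (a⁻¹ * b) *ᵥ baseVec k = baseVec k := h
    rw [mat_mul, ← mulVec_mulVec] at h2
    change mat a *ᵥ baseVec k = mat b *ᵥ baseVec k
    rw [← h2, mat_mulVec_inv_mulVec]
    simp [h2]

theorem pt_proj {k : ℕ} (g : G k) : pt (proj g) = mat g *ᵥ baseVec k := rfl

theorem pt_smul {k : ℕ} (g : G k) (p : AdS k) : pt (g • p) = mat g *ᵥ pt p := by
  induction p using QuotientGroup.induction_on with
  | H h =>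
    change mat (g * h) *ᵥ baseVec k = mat g *ᵥ (mat h *ᵥ baseVec k)
    rw [mat_mul, mulVec_mulVec]

theorem pt_injective {k : ℕ} : Function.Injective (pt (k := k)) := by
  intro p q
  induction p using QuotientGroup.induction_on with
  | H a =>
    induction q using QuotientGroup.induction_on with
    | H b =>
      intro h
      refine QuotientGroup.eq.2 ?_
      change mat (a⁻¹ * b) *ᵥ baseVec k = baseVec k
      change mat a *ᵥ baseVec k = mat b *ᵥ baseVec k at h
      rw [mat_mul, ← mulVec_mulVec, ← h, mat_inv_mulVec_mulVec]

theorem continuous_mat {k : ℕ} : Continuous (mat : G k → Matrix (Idx k) (Idx k) ℝ) :=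
  Units.continuous_val.comp continuous_subtype_val

theorem continuous_pt {k : ℕ} : Continuous (pt (k := k)) :=
  (continuous_mat.matrix_mulVec continuous_const).quotient_lift _

theorem form_baseVec {k : ℕ} : form (baseVec k) (baseVec k) = 1 := by
  simp [form_apply, baseVec]

theorem form_pt {k : ℕ} (p : AdS k) : form (pt p) (pt p) = 1 := by
  induction p using QuotientGroup.induction_on with
  | H g => exact (form_mulVec g _ _).trans form_baseVec

instance {k : ℕ} : PreconnectedSpace (G k) := by
  refine Subtype.preconnectedSpace ?_
  have h : IsPreconnected ((Subgroup.connectedComponentOfOne (SO2 k) : Subgroup (SO2 k)) :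
      Set (SO2 k)) := isPreconnected_connectedComponent
  exact h.image _ continuous_subtype_val.continuousOn

theorem continuous_expG {k : ℕ} : Continuous (expG (k := k)) :=
  ((continuous_expGL k).comp continuous_subtype_val).subtype_mk _

/-! ### Closed orbits of the Iwasawa groups -/

instance {k : ℕ} : PreconnectedSpace (AdS k) :=
  ⟨by
    rw [← (QuotientGroup.mk_surjective (s := H k)).range_eq]
    exact isPreconnected_range QuotientGroup.continuous_mk⟩

theorem continuous_form_pt {k : ℕ} (l : Idx k → ℝ) : Continuous fun p : AdS k => form l (pt p) :=
  continuous_const.dotProduct (continuous_const.matrix_mulVec continuous_pt)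

theorem mem_orbit_of_mulVec_eq {k : ℕ} {P : Subgroup (G k)} {p q : AdS k} {g : G k} (hg : g ∈ P)
    (h : mat g *ᵥ pt p = pt q) : q ∈ MulAction.orbit P p :=
  ⟨⟨g, hg⟩, pt_injective ((pt_smul g p).trans h)⟩

theorem exists_exp_mul_eq {x y : ℝ} (h : 0 < x * y) : ∃ s : ℝ, Real.exp s * x = y := by
  have hx : x ≠ 0 := left_ne_zero_of_mul h.ne'
  have hyx : 0 < y / x := by
    rw [show y / x = x * y / (x * x) by field_simp]
    exact div_pos h (mul_self_pos.2 hx)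
  exact ⟨Real.log (y / x), by rw [Real.exp_log hyx, div_mul_cancel₀ _ hx]⟩

/-- The orbits of a group which contains the unipotent and diagonal elements adapted to an isotropic
flag `⟨l⟩ ⊂ ⟨l, m⟩` and preserves the line of `l` are closed exactly in the hyperplane `l^⊥`. -/
theorem isClosed_orbit_iff {k : ℕ} {P : Subgroup (G k)} {l m : Idx k → ℝ}
    (hl : form l l = 0) (hm : form m m = 0)
    (hbase : form l (baseVec k) = 0)
    (hne : ∀ v : Idx k → ℝ, form v v = 1 → form l v = 0 → form m v ≠ 0)
    (hPl : ∀ w, form l w = 0 → expG (wedge l w) ∈ P)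
    (hPm : ∀ w, form l w = 0 → form m w = 0 → expG (wedge m w) ∈ P)
    (hAl : ∀ s : ℝ, ∃ g ∈ P, mat g *ᵥ l = Real.exp s • l)
    (hAm : ∀ s : ℝ, ∃ g ∈ P, mat g *ᵥ l = l ∧ mat g *ᵥ m = Real.exp s • m)
    (hP : ∀ g ∈ P, ∃ c : ℝ, mat g *ᵥ l = c • l) (p : AdS k) :
    IsClosed (MulAction.orbit P p) ↔ form l (pt p) = 0 := by
  have horb : ∀ {q : AdS k}, q ∈ MulAction.orbit P p →
      (form l (pt p) = 0 ↔ form l (pt q) = 0) := by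
    have key : ∀ g ∈ P, ∀ q : AdS k, form l (pt q) = 0 → form l (pt (g • q)) = 0 := by
      intro g hg q hq
      obtain ⟨c, hc⟩ := hP g⁻¹ (P.inv_mem hg)
      rw [pt_smul, form_mulVec_right, hc, form_smul_left, hq, mul_zero]
    rintro _ ⟨⟨g, hg⟩, rfl⟩
    refine ⟨key g hg p, fun h => ?_⟩
    have := key g⁻¹ (P.inv_mem hg) _ h
    change form l (pt (g⁻¹ • (g • p))) = 0 at this
    rwa [inv_smul_smul] at this
  by_cases h0 : form l (pt p) = 0
  · refine iff_of_true ?_ h0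
    -- each half of the hyperplane section is contained in a single orbit
    have htrans : ∀ q r : AdS k, form l (pt q) = 0 → form l (pt r) = 0 →
        0 < form m (pt q) * form m (pt r) → q ∈ MulAction.orbit P p → r ∈ MulAction.orbit P p := by
      intro q r hq hr hqr hqo
      -- A diagonal element fixing $l$ first matches the products with $m$; a unipotent
      -- $\exp(m\wedge w)$ with $w\perp l,m$ then carries one point to the other.
      obtain ⟨s, hs⟩ := exists_exp_mul_eq hqr
      obtain ⟨g, hg, hgl, hgm⟩ := hAm s
      have h1 : form l (pt (g⁻¹ • q)) = 0 := by
        rw [pt_smul, form_mulVec_right, inv_inv, hgl, hq]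
      have h2 : form m (pt (g⁻¹ • q)) = form m (pt r) := by
        rw [pt_smul, form_mulVec_right, inv_inv, hgm, form_smul_left, hs]
      have h3 : form m (pt (g⁻¹ • q)) ≠ 0 := hne _ (form_pt _) h1
      have h4 := exp_wedge_transport hm (form_pt _) (form_pt r) h3 h2.symm
      have h5 : r ∈ MulAction.orbit P (g⁻¹ • q) := mem_orbit_of_mulVec_eq
        (hPm _ (by rw [form_smul_right, form_sub_right, hr, h1, sub_zero, mul_zero])
          (by rw [form_smul_right, form_sub_right, h2, sub_self, mul_zero])) h4
      have h6 : g⁻¹ • q ∈ MulAction.orbit P q := ⟨⟨g⁻¹, P.inv_mem hg⟩, rfl⟩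
      rw [← MulAction.orbit_eq_iff] at hqo h5 h6 ⊢
      rw [h5, h6, hqo]
    have hS : ∀ r : AdS k, r ∈ closure (MulAction.orbit P p) → form l (pt r) = 0 := fun r hr =>
      closure_minimal (fun q hq => (horb hq).1 h0)
        (isClosed_eq (continuous_form_pt l) continuous_const) hr
    -- A limit point $r$ is still orthogonal to $l$, so $\langle m,r\rangle\ne0$, and nearby points
    -- of the orbit have a product with $m$ of the same sign. They lie in the orbit of $r$.
    refine isClosed_of_closure_subset fun r hr => ?_
    have hr0 := hne _ (form_pt r) (hS r hr)
    have hopen : IsOpen {q : AdS k | 0 < form m (pt q) * form m (pt r)} :=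
      isOpen_lt continuous_const ((continuous_form_pt m).mul continuous_const)
    obtain ⟨q, hq, hqo⟩ := mem_closure_iff.1 hr _ hopen (mul_self_pos.2 hr0)
    exact htrans q r ((horb hqo).1 h0) (hS r hr) hq hqo
  -- Off the hyperplane the orbit contains all points on its side, so it is open. Were it closed as
  -- well, connectedness would make it all of $AdS$, yet the base point lies on the hyperplane.
  · refine iff_of_false (fun hcl => ?_) h0
    have htrans : ∀ q r : AdS k, 0 < form l (pt q) * form l (pt r) →
        q ∈ MulAction.orbit P p → r ∈ MulAction.orbit P p := by
      intro q r hqr hqo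
      obtain ⟨s, hs⟩ := exists_exp_mul_eq hqr
      obtain ⟨g, hg, hgl⟩ := hAl s
      have h2 : form l (pt (g⁻¹ • q)) = form l (pt r) := by
        rw [pt_smul, form_mulVec_right, inv_inv, hgl, form_smul_left, hs]
      have h3 : form l (pt (g⁻¹ • q)) ≠ 0 := h2 ▸ right_ne_zero_of_mul hqr.ne'
      have h4 := exp_wedge_transport hl (form_pt _) (form_pt r) h3 h2.symm
      have h5 : r ∈ MulAction.orbit P (g⁻¹ • q) := mem_orbit_of_mulVec_eq
        (hPl _ (by rw [form_smul_right, form_sub_right, h2, sub_self, mul_zero])) h4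
      have h6 : g⁻¹ • q ∈ MulAction.orbit P q := ⟨⟨g⁻¹, P.inv_mem hg⟩, rfl⟩
      rw [← MulAction.orbit_eq_iff] at hqo h5 h6 ⊢
      rw [h5, h6, hqo]
    have hopen : IsOpen (MulAction.orbit P p) := by
      refine isOpen_iff_mem_nhds.2 fun q hq => ?_
      have hq0 : form l (pt q) ≠ 0 := fun h => h0 ((horb hq).2 h)
      have ho : IsOpen {r : AdS k | 0 < form l (pt q) * form l (pt r)} :=
        isOpen_lt continuous_const (continuous_const.mul (continuous_form_pt l))
      exact Filter.mem_of_superset (ho.mem_nhds (mul_self_pos.2 hq0)) fun r hr => htrans q r hr hq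
    have huniv := IsClopen.eq_univ ⟨hcl, hopen⟩ ⟨p, MulAction.mem_orbit_self p⟩
    have h1 : proj (1 : G k) ∈ MulAction.orbit P p := huniv ▸ Set.mem_univ _
    exact h0 ((horb h1).2 (by rw [pt_proj, mat_one, one_mulVec, hbase]))

/-- The null vector `e_t + ε e_{x₂}`. -/
def lvec (k : ℕ) (ε : ℝ) : Idx k → ℝ := Pi.single (Sum.inl 1) 1 + Pi.single (Sum.inr 1) ε

/-- The null vector `e_u + ε e_{x₁}`. -/
def mvec (k : ℕ) (ε : ℝ) : Idx k → ℝ := Pi.single (Sum.inl 0) 1 + Pi.single (Sum.inr 0) ε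

theorem form_lvec {k : ℕ} (ε : ℝ) (v : Idx k → ℝ) :
    form (lvec k ε) v = v (Sum.inl 1) - ε * v (Sum.inr 1) := by
  simp [form_apply, lvec, Fin.ext_iff]

theorem form_mvec {k : ℕ} (ε : ℝ) (v : Idx k → ℝ) :
    form (mvec k ε) v = v (Sum.inl 0) - ε * v (Sum.inr 0) := by
  simp [form_apply, mvec, Fin.ext_iff]

theorem J1_mulVec {k : ℕ} (v : Idx k → ℝ) :
    (J1 k).1 *ᵥ v = v (Sum.inr 1) • Pi.single (Sum.inl 1) 1 +
      v (Sum.inl 1) • Pi.single (Sum.inr 1) 1 := by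
  rw [J1, boost, add_mulVec]
  ext i
  simp [Matrix.single_mulVec, Pi.single_apply, Function.update_apply]

theorem J2_mulVec {k : ℕ} (v : Idx k → ℝ) :
    (J2 k).1 *ᵥ v = v (Sum.inr 0) • Pi.single (Sum.inl 0) 1 +
      v (Sum.inl 0) • Pi.single (Sum.inr 0) 1 := by
  rw [J2, boost, add_mulVec]
  ext i
  simp [Matrix.single_mulVec, Pi.single_apply, Function.update_apply]

theorem J1_lvec {k : ℕ} {ε : ℝ} (hε : ε * ε = 1) : (J1 k).1 *ᵥ lvec k ε = ε • lvec k ε := by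
  rw [J1_mulVec]
  ext i
  rcases i with i | i <;> by_cases h : i = 1 <;> simp [lvec, h, hε]

theorem J2_mvec {k : ℕ} {ε : ℝ} (hε : ε * ε = 1) : (J2 k).1 *ᵥ mvec k ε = ε • mvec k ε := by
  rw [J2_mulVec]
  ext i
  rcases i with i | i <;> by_cases h : i = 0 <;> simp [mvec, h, hε]

theorem J1_mvec {k : ℕ} (ε : ℝ) : (J1 k).1 *ᵥ mvec k ε = 0 := by
  rw [J1_mulVec]
  simp [mvec]

theorem J2_lvec {k : ℕ} (ε : ℝ) : (J2 k).1 *ᵥ lvec k ε = 0 := by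
  rw [J2_mulVec]
  simp [lvec]

theorem eq_smul_lvec_of_J1 {k : ℕ} {ε : ℝ} (hε : ε * ε = 1) {z : Idx k → ℝ}
    (h : (J1 k).1 *ᵥ z = ε • z) : z = z (Sum.inl 1) • lvec k ε := by
  have hε0 : ε ≠ 0 := left_ne_zero_of_mul_eq_one hε
  rw [J1_mulVec] at h
  ext i
  have hi := congrFun h i
  rcases i with i | i
  · by_cases h1 : i = 1
    · subst h1
      simp [lvec]
    · simpa [lvec, Pi.single_apply, h1, hε0] using hi
  · by_cases h1 : i = 1
    · subst h1
      simp at hi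
      simp [lvec]
      linear_combination ε * (-hi) - z (Sum.inr 1) * hε
    · simpa [lvec, Pi.single_apply, h1, hε0] using hi

theorem eq_zero_of_J1 {k : ℕ} {z : Idx k → ℝ} (h : (J1 k).1 *ᵥ z = (2 : ℝ) • z) : z = 0 := by
  rw [J1_mulVec] at h
  have ht : z (Sum.inr 1) = 2 * z (Sum.inl 1) := by simpa using congrFun h (Sum.inl 1)
  have hx : z (Sum.inl 1) = 2 * z (Sum.inr 1) := by simpa using congrFun h (Sum.inr 1)
  ext i
  have hi := congrFun h i
  rcases i with i | i
  · by_cases h1 : i = 1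
    · subst h1
      simp
      linarith
    · simpa [Pi.single_apply, h1, eq_comm] using hi
  · by_cases h1 : i = 1
    · subst h1
      simp
      linarith
    · simpa [Pi.single_apply, h1, eq_comm] using hi

/-! ### Root vectors as wedges of weight vectors. -/

theorem wedge_mem_rootSpace {k : ℕ} {x y : Idx k → ℝ} {α β α' β' : ℝ}
    (hx1 : (J1 k).1 *ᵥ x = α • x) (hx2 : (J2 k).1 *ᵥ x = β • x)
    (hy1 : (J1 k).1 *ᵥ y = α' • y) (hy2 : (J2 k).1 *ᵥ y = β' • y) :
    wedge x y ∈ rootSpace k (α + α') (β + β') := by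
  constructor
  · rw [lie_wedge, hx1, hy1, wedge_smul_left, wedge_smul_right, add_smul]
  · rw [lie_wedge, hx2, hy2, wedge_smul_left, wedge_smul_right, add_smul]

theorem rootSpace_le_nilp (k : ℕ) : rootSpace k 1 0 ≤ nilp k ∧ rootSpace k 0 1 ≤ nilp k ∧
    rootSpace k 1 1 ≤ nilp k ∧ rootSpace k 1 (-1) ≤ nilp k :=
  ⟨le_sup_of_le_left (le_sup_of_le_left le_sup_left),
    le_sup_of_le_left (le_sup_of_le_left le_sup_right),
    le_sup_of_le_left le_sup_right, le_sup_right⟩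

theorem exists_decomposition {k : ℕ} (w : Idx k → ℝ) : ∃ r : Idx k → ℝ,
    (J1 k).1 *ᵥ r = 0 ∧ (J2 k).1 *ᵥ r = 0 ∧
    w = ((w (Sum.inl 1) + w (Sum.inr 1)) / 2) • lvec k 1 +
      ((w (Sum.inl 1) - w (Sum.inr 1)) / 2) • lvec k (-1) +
      ((w (Sum.inl 0) + w (Sum.inr 0)) / 2) • mvec k 1 +
      ((w (Sum.inl 0) - w (Sum.inr 0)) / 2) • mvec k (-1) + r := by
  refine ⟨w - (((w (Sum.inl 1) + w (Sum.inr 1)) / 2) • lvec k 1 +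
      ((w (Sum.inl 1) - w (Sum.inr 1)) / 2) • lvec k (-1) +
      ((w (Sum.inl 0) + w (Sum.inr 0)) / 2) • mvec k 1 +
      ((w (Sum.inl 0) - w (Sum.inr 0)) / 2) • mvec k (-1)), ?_, ?_, by abel⟩
  · rw [J1_mulVec]
    have h1 : ∀ a b : ℝ, a - ((a + b) / 2 + (a - b) / 2) = 0 := fun a b => by ring
    have h2 : ∀ a b : ℝ, b - ((a + b) / 2 + -((a - b) / 2)) = 0 := fun a b => by ring
    simp [lvec, mvec, h1, h2]
  · rw [J2_mulVec]
    have h1 : ∀ a b : ℝ, a - ((a + b) / 2 + (a - b) / 2) = 0 := fun a b => by ring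
    have h2 : ∀ a b : ℝ, b - ((a + b) / 2 + -((a - b) / 2)) = 0 := fun a b => by ring
    simp [lvec, mvec, h1, h2]

/-- Orthogonality to $l=e_t+e_{x_2}$ removes the component of $w$ along $e_t-e_{x_2}$, and the one
along $l$ does not matter. What remains gives wedges of weights $(1,1)$, $(1,-1)$ and $(1,0)$. -/
theorem wedge_lvec_mem_nilp {k : ℕ} {w : Idx k → ℝ} (hw : form (lvec k 1) w = 0) :
    wedge (lvec k 1) w ∈ nilp k := by
  obtain ⟨h10, _, h11, h12⟩ := rootSpace_le_nilp k
  obtain ⟨r, hr1, hr2, hr⟩ := exists_decomposition w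
  rw [form_lvec, one_mul] at hw
  have e1 : (J1 k).1 *ᵥ lvec k 1 = (1 : ℝ) • lvec k 1 := J1_lvec (by norm_num)
  have e2 : (J2 k).1 *ᵥ lvec k 1 = (0 : ℝ) • lvec k 1 := by rw [J2_lvec, zero_smul]
  have e3 : ∀ ε, (J1 k).1 *ᵥ mvec k ε = (0 : ℝ) • mvec k ε := fun ε => by rw [J1_mvec, zero_smul]
  have a1 := h11 (by simpa using wedge_mem_rootSpace e1 e2 (e3 1) (J2_mvec (by norm_num)))
  have a2 := h12 (by simpa using wedge_mem_rootSpace e1 e2 (e3 (-1)) (J2_mvec (by norm_num)))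
  have a3 := wedge_mem_rootSpace e1 e2 (hr1.trans (zero_smul ℝ r).symm)
    (hr2.trans (zero_smul ℝ r).symm)
  simp only [add_zero] at a3
  replace a3 := h10 a3
  rw [hr, hw, zero_div, zero_smul, add_zero]
  simp only [wedge_add_right, wedge_smul_right, wedge_self, smul_zero, zero_add]
  exact add_mem (add_mem (Submodule.smul_mem _ _ a1) (Submodule.smul_mem _ _ a2)) a3

/-- The two orthogonality conditions remove the components that would give weights $(-1,1)$ and
$(0,0)$; only $(1,1)$ and $(0,1)$ are left. -/
theorem wedge_mvec_mem_nilp {k : ℕ} {w : Idx k → ℝ} (hw : form (lvec k 1) w = 0)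
    (hw' : form (mvec k 1) w = 0) : wedge (mvec k 1) w ∈ nilp k := by
  obtain ⟨_, h01, h11, _⟩ := rootSpace_le_nilp k
  obtain ⟨r, hr1, hr2, hr⟩ := exists_decomposition w
  rw [form_lvec, one_mul] at hw
  rw [form_mvec, one_mul] at hw'
  have e1 : (J1 k).1 *ᵥ mvec k 1 = (0 : ℝ) • mvec k 1 := by rw [J1_mvec, zero_smul]
  have e2 : (J2 k).1 *ᵥ mvec k 1 = (1 : ℝ) • mvec k 1 := J2_mvec (by norm_num)
  have a1 := wedge_mem_rootSpace e1 e2 (J1_lvec (ε := 1) (by norm_num))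
    ((J2_lvec 1).trans (zero_smul ℝ _).symm)
  simp only [add_zero, zero_add] at a1
  replace a1 := h11 a1
  have a3 := wedge_mem_rootSpace e1 e2 (hr1.trans (zero_smul ℝ r).symm)
    (hr2.trans (zero_smul ℝ r).symm)
  simp only [add_zero] at a3
  replace a3 := h01 a3
  rw [hr, hw, hw', zero_div, zero_smul, zero_smul, add_zero, add_zero]
  simp only [wedge_add_right, wedge_smul_right, wedge_self, smul_zero, add_zero]
  exact add_mem (Submodule.smul_mem _ _ a1) a3

/-! ### The Cartan involution as conjugation by the Gram matrix. -/

theorem eta_mulVec_eta_mulVec {k : ℕ} (v : Idx k → ℝ) : eta k *ᵥ (eta k *ᵥ v) = v := by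
  rw [mulVec_mulVec, eta_mul_eta, one_mulVec]

theorem eta_mulVec_lvec {k : ℕ} (ε : ℝ) : eta k *ᵥ lvec k ε = lvec k (-ε) := by
  ext i
  rcases i with i | i
  · simp [eta_mulVec_inl, lvec]
  · by_cases h : i = 1 <;> simp [eta_mulVec_inr, lvec, h]

theorem eta_mulVec_mvec {k : ℕ} (ε : ℝ) : eta k *ᵥ mvec k ε = mvec k (-ε) := by
  ext i
  rcases i with i | i
  · simp [eta_mulVec_inl, mvec]
  · by_cases h : i = 0 <;> simp [eta_mulVec_inr, mvec, h]

theorem form_eta_mulVec {k : ℕ} (v w : Idx k → ℝ) : form (eta k *ᵥ v) w = form v (eta k *ᵥ w) := by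
  rw [form, form, eta_mulVec_eta_mulVec, dotProduct_mulVec, vecMul_mulVec, eta_transpose,
    eta_mul_eta, vecMul_one]

theorem theta_mulVec {k : ℕ} (X : so k) (v : Idx k → ℝ) :
    (theta k X).1 *ᵥ (eta k *ᵥ v) = eta k *ᵥ (X.1 *ᵥ v) := by
  change (-X.1.transpose) *ᵥ _ = _
  rw [neg_mulVec, mulVec_mulVec, mem_so_iff.1 X.2, neg_mulVec, neg_neg, mulVec_mulVec]

theorem theta_wedge {k : ℕ} (x y : Idx k → ℝ) :
    theta k (wedge x y) = wedge (eta k *ᵥ x) (eta k *ᵥ y) := by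
  refine so_ext fun v => ?_
  rw [← eta_mulVec_eta_mulVec v, theta_mulVec, wedge_mulVec, wedge_mulVec, mulVec_sub, mulVec_smul,
    mulVec_smul, form_eta_mulVec, form_eta_mulVec]
  simp only [eta_mulVec_eta_mulVec]

theorem wedge_lvec_mem_nilpBar {k : ℕ} {w : Idx k → ℝ} (hw : form (lvec k (-1)) w = 0) :
    wedge (lvec k (-1)) w ∈ nilpBar k := by
  refine ⟨wedge (lvec k 1) (eta k *ᵥ w), wedge_lvec_mem_nilp ?_, ?_⟩
  · rw [← form_eta_mulVec, eta_mulVec_lvec, hw]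
  · rw [theta_wedge, eta_mulVec_eta_mulVec, eta_mulVec_lvec]

theorem wedge_mvec_mem_nilpBar {k : ℕ} {w : Idx k → ℝ} (hw : form (lvec k (-1)) w = 0)
    (hw' : form (mvec k (-1)) w = 0) : wedge (mvec k (-1)) w ∈ nilpBar k := by
  refine ⟨wedge (mvec k 1) (eta k *ᵥ w), wedge_mvec_mem_nilp ?_ ?_, ?_⟩
  · rw [← form_eta_mulVec, eta_mulVec_lvec, hw]
  · rw [← form_eta_mulVec, eta_mulVec_mvec, hw']
  · rw [theta_wedge, eta_mulVec_eta_mulVec, eta_mulVec_mvec]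

/-- The elements of the Lie algebra which preserve the line of `v`. -/
def eigenSubmodule {k : ℕ} (v : Idx k → ℝ) : Submodule ℝ (so k) where
  carrier := {X | ∃ c : ℝ, X.1 *ᵥ v = c • v}
  zero_mem' := ⟨0, by rw [zero_smul]; exact zero_mulVec v⟩
  add_mem' := by
    rintro X Y ⟨c, hc⟩ ⟨d, hd⟩
    exact ⟨c + d, by rw [so_coe_add, add_mulVec, hc, hd, add_smul]⟩
  smul_mem' := by
    rintro a X ⟨c, hc⟩
    exact ⟨a * c, by rw [so_coe_smul, smul_mulVec, hc, smul_smul]⟩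

/-- The elements of the group which preserve the line of `v`. -/
def lineStabilizer {k : ℕ} (v : Idx k → ℝ) : Subgroup (G k) where
  carrier := {g | ∃ c : ℝ, c ≠ 0 ∧ mat g *ᵥ v = c • v}
  one_mem' := ⟨1, one_ne_zero, by rw [mat_one, one_mulVec, one_smul]⟩
  mul_mem' := by
    rintro g h ⟨c, hc, hg⟩ ⟨d, hd, hh⟩
    exact ⟨c * d, mul_ne_zero hc hd, by
      rw [mat_mul, ← mulVec_mulVec, hh, mulVec_smul, hg, smul_smul, mul_comm]⟩
  inv_mem' := by
    rintro g ⟨c, hc, hg⟩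
    refine ⟨c⁻¹, inv_ne_zero hc, ?_⟩
    have h := congrArg (fun z => c⁻¹ • (mat g⁻¹ *ᵥ z)) hg
    simp only [mat_inv_mulVec_mulVec, mulVec_smul, smul_smul, inv_mul_cancel₀ hc, one_smul] at h
    exact h.symm

theorem expSubgroup_le_lineStabilizer {k : ℕ} {v : Idx k → ℝ} {V : Submodule ℝ (so k)}
    (h : V ≤ eigenSubmodule v) : expSubgroup V ≤ lineStabilizer v := by
  refine (Subgroup.closure_le _).2 ?_
  rintro _ ⟨X, hX, rfl⟩
  obtain ⟨c, hc⟩ := h hX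
  exact ⟨Real.exp c, (Real.exp_pos c).ne', exp_mulVec_of_eigen hc⟩

theorem cartan_le_eigenSubmodule {k : ℕ} {ε : ℝ} (hε : ε * ε = 1) :
    cartan k ≤ eigenSubmodule (lvec k ε) := by
  refine Submodule.span_le.2 ?_
  rintro X (rfl | rfl)
  · exact ⟨ε, J1_lvec hε⟩
  · exact ⟨0, by rw [J2_lvec, zero_smul]⟩

/-- A root vector of $J_1$-weight $\alpha$ sends `lvec k 1`, of weight $1$, to weight $\alpha+1$.
For $\alpha=1$ the result vanishes, since $2$ is not an eigenvalue of $J_1$ on vectors; for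
$\alpha=0$ it stays in the eigenline. -/
theorem nilp_le_eigenSubmodule (k : ℕ) : nilp k ≤ eigenSubmodule (lvec k 1) := by
  have key : ∀ {α β : ℝ} {X : so k}, X ∈ rootSpace k α β →
      (J1 k).1 *ᵥ (X.1 *ᵥ lvec k 1) = (α + 1) • (X.1 *ᵥ lvec k 1) := by
    rintro α β X ⟨h, -⟩
    have h1 : (⁅J1 k, X⁆ : so k).1 *ᵥ lvec k 1 = (α • X : so k).1 *ᵥ lvec k 1 := by rw [h]
    rw [lie_mulVec, J1_lvec (by norm_num), one_smul, so_coe_smul, smul_mulVec, sub_eq_iff_eq_add]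
      at h1
    rw [h1, add_smul, one_smul]
  have key1 : ∀ β : ℝ, rootSpace k 1 β ≤ eigenSubmodule (lvec k 1) := fun β X hX =>
    ⟨0, by rw [zero_smul]; exact eq_zero_of_J1 (by rw [key hX]; norm_num)⟩
  refine sup_le (sup_le (sup_le (key1 0) fun X hX => ?_) (key1 1)) (key1 (-1))
  exact ⟨_, eq_smul_lvec_of_J1 (by norm_num) (by rw [key hX, zero_add])⟩

theorem nilpBar_le_eigenSubmodule (k : ℕ) : nilpBar k ≤ eigenSubmodule (lvec k (-1)) := by
  rintro _ ⟨X, hX, rfl⟩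
  obtain ⟨c, hc⟩ := nilp_le_eigenSubmodule k hX
  exact ⟨c, by rw [← eta_mulVec_lvec, theta_mulVec, hc, mulVec_smul]⟩

theorem lvec_null {k : ℕ} {ε : ℝ} (hε : ε * ε = 1) : form (lvec k ε) (lvec k ε) = 0 := by
  rw [form_lvec]
  simp [lvec, hε]

theorem mvec_null {k : ℕ} {ε : ℝ} (hε : ε * ε = 1) : form (mvec k ε) (mvec k ε) = 0 := by
  rw [form_mvec]
  simp [mvec, hε]

theorem form_lvec_mvec {k : ℕ} (ε δ : ℝ) : form (lvec k ε) (mvec k δ) = 0 := by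
  simp [form_lvec, mvec]

/-- The orthogonal of the isotropic plane spanned by `lvec k ε` and `mvec k ε` is negative
semidefinite, so it contains no vector of norm $1$. -/
theorem form_mvec_ne_zero {k : ℕ} {ε : ℝ} (hε : ε * ε = 1) {v : Idx k → ℝ} (hv : form v v = 1)
    (h : form (lvec k ε) v = 0) : form (mvec k ε) v ≠ 0 := by
  intro h'
  rw [form_lvec, sub_eq_zero] at h
  rw [form_mvec, sub_eq_zero] at h'
  have hs : 0 ≤ ∑ i : Fin k, v (Sum.inr i.succ.succ) * v (Sum.inr i.succ.succ) :=
    Finset.sum_nonneg fun i _ => mul_self_nonneg _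
  rw [form_apply, h, h'] at hv
  nlinarith

theorem isClosed_orbit_iff_of_le {k : ℕ} {ε : ℝ} (hε : ε * ε = 1) {n : Submodule ℝ (so k)}
    (hl : ∀ w, form (lvec k ε) w = 0 → wedge (lvec k ε) w ∈ n)
    (hm : ∀ w, form (lvec k ε) w = 0 → form (mvec k ε) w = 0 → wedge (mvec k ε) w ∈ n)
    (hn : n ≤ eigenSubmodule (lvec k ε)) (p : AdS k) :
    IsClosed (MulAction.orbit (expSubgroup (cartan k) ⊔ expSubgroup n : Subgroup (G k)) p) ↔
      form (lvec k ε) (pt p) = 0 := by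
  have hA : ∀ X ∈ cartan k,
      expG X ∈ (expSubgroup (cartan k) ⊔ expSubgroup n : Subgroup (G k)) := fun X hX =>
    (le_sup_left : expSubgroup (cartan k) ≤ _) (Subgroup.subset_closure ⟨X, hX, rfl⟩)
  have hN : ∀ X ∈ n,
      expG X ∈ (expSubgroup (cartan k) ⊔ expSubgroup n : Subgroup (G k)) := fun X hX =>
    (le_sup_right : expSubgroup n ≤ _) (Subgroup.subset_closure ⟨X, hX, rfl⟩)
  refine isClosed_orbit_iff (lvec_null hε) (mvec_null hε) ?_
    (fun v hv h => form_mvec_ne_zero hε hv h) (fun w hw => hN _ (hl w hw))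
    (fun w hw hw' => hN _ (hm w hw hw')) (fun s => ?_) (fun s => ?_) (fun g hg => ?_) p
  · simp [form_lvec, baseVec]
  · refine ⟨expG ((s * ε) • J1 k), hA _ (Submodule.smul_mem _ _
      (Submodule.subset_span (Set.mem_insert _ _))), exp_mulVec_of_eigen ?_⟩
    rw [so_coe_smul, smul_mulVec, J1_lvec hε, smul_smul, mul_assoc, hε, mul_one]
  · refine ⟨expG ((s * ε) • J2 k), hA _ (Submodule.smul_mem _ _
      (Submodule.subset_span (Set.mem_insert_of_mem _ rfl))), ?_, exp_mulVec_of_eigen ?_⟩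
    · have h0 : ((s * ε) • J2 k : so k).1 *ᵥ lvec k ε = (0 : ℝ) • lvec k ε := by
        rw [so_coe_smul, smul_mulVec, J2_lvec, smul_zero, zero_smul]
      rw [mat_expG, exp_mulVec_of_eigen h0, Real.exp_zero, one_smul]
    · rw [so_coe_smul, smul_mulVec, J2_mvec hε, smul_smul, mul_assoc, hε, mul_one]
  · obtain ⟨c, -, hc⟩ := sup_le (expSubgroup_le_lineStabilizer (cartan_le_eigenSubmodule hε))
      (expSubgroup_le_lineStabilizer hn) hg
    exact ⟨c, hc⟩

/-- The singularity is given by the equation `t² = x₂²`. -/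
theorem mem_Singularity_iff {k : ℕ} (p : AdS k) : p ∈ Singularity k ↔
    (pt p (Sum.inl 1) - pt p (Sum.inr 1)) * (pt p (Sum.inl 1) + pt p (Sum.inr 1)) = 0 := by
  have h1 := isClosed_orbit_iff_of_le (ε := 1) (by norm_num) (fun w => wedge_lvec_mem_nilp)
    (fun w => wedge_mvec_mem_nilp) (nilp_le_eigenSubmodule k) p
  have h2 := isClosed_orbit_iff_of_le (ε := -1) (by norm_num) (fun w => wedge_lvec_mem_nilpBar)
    (fun w => wedge_mvec_mem_nilpBar) (nilpBar_le_eigenSubmodule k) p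
  rw [form_lvec, one_mul] at h1
  rw [form_lvec, neg_one_mul, sub_neg_eq_add] at h2
  rw [mul_eq_zero, ← h1, ← h2]
  rfl

/-! ### Light-like geodesics -/

/-- The null tangent vector `e_t + ∑ w_i e_{x_i}` at the base point. -/
def nullVec {k : ℕ} (w : Fin (k + 2) → ℝ) : Idx k → ℝ := Sum.elim ![0, 1] w

theorem form_eq_sum {k : ℕ} (v w : Idx k → ℝ) :
    form v w = v (Sum.inl 0) * w (Sum.inl 0) + v (Sum.inl 1) * w (Sum.inl 1)
      - ∑ i, v (Sum.inr i) * w (Sum.inr i) := by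
  rw [form, dotProduct, Fintype.sum_sum_type]
  simp only [eta_mulVec_inl, eta_mulVec_inr, Fin.sum_univ_two, mul_neg, Finset.sum_neg_distrib]
  ring

theorem form_nullVec_self {k : ℕ} {w : Fin (k + 2) → ℝ} (hw : ∑ i, w i ^ 2 = 1) :
    form (nullVec w) (nullVec w) = 0 := by
  simp only [pow_two] at hw
  simp [form_eq_sum, nullVec, hw]

theorem form_baseVec_left {k : ℕ} (v : Idx k → ℝ) : form (baseVec k) v = v (Sum.inl 0) := by
  simp [form_apply, baseVec]

theorem direction_eq_wedge {k : ℕ} (w : Fin (k + 2) → ℝ) :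
    direction w = wedge (baseVec k) (nullVec w) := by
  refine so_ext fun v => ?_
  have h : (direction w).1 = (q0 k).1 + ∑ i, w i • (boost (k := k) 0 i).1 := by
    rw [direction, so_coe_add]
    congr 1
    exact map_sum (so k).toSubmodule.subtype _ _
  rw [h, wedge_mulVec, form_baseVec_left, form_eq_sum, add_mulVec, Matrix.sum_mulVec]
  ext i
  rcases i with i | i
  · fin_cases i <;>
    simp [q0, boost, nullVec, baseVec, sub_mulVec, add_mulVec, Matrix.single_mulVec,
      Finset.sum_apply]
    ring
  · simp [q0, boost, nullVec, baseVec, sub_mulVec, add_mulVec, Matrix.single_mulVec,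
      Finset.sum_apply, Function.update_apply, mul_comm]

theorem pt_geodesic {k : ℕ} (g : G k) {w : Fin (k + 2) → ℝ} (hw : ∑ i, w i ^ 2 = 1) (s : ℝ) :
    pt (geodesic g w s) = mat g *ᵥ baseVec k + s • (mat g *ᵥ nullVec w) := by
  -- The factors are swapped to put the null one first, as `exp_wedge_mulVec` requires; as it is
  -- orthogonal to $e_u$, no quadratic term survives and the geodesic is a straight line.
  have h : s • direction w = wedge (nullVec w) ((-s) • baseVec k) := by
    refine so_ext fun v => ?_
    rw [direction_eq_wedge, so_coe_smul, smul_mulVec, wedge_mulVec, wedge_mulVec, form_smul_left]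
    module
  have h0 : form (nullVec w) (baseVec k) = 0 := by
    rw [form_comm, form_baseVec_left]; rfl
  rw [geodesic, pt_proj, mat_mul, ← mulVec_mulVec, h, exp_wedge_mulVec (form_nullVec_self hw)
    (by rw [form_smul_right, h0, mul_zero]), h0, form_smul_left, form_baseVec]
  simp [mulVec_add, mulVec_smul]

/-- The quantity whose sign tells the future directed tangent vectors `ξ` at `v`. -/
def futureSign {k : ℕ} (v ξ : Idx k → ℝ) : ℝ :=
  v (Sum.inl 0) * ξ (Sum.inl 1) - v (Sum.inl 1) * ξ (Sum.inl 0)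

theorem futureSign_smul {k : ℕ} (c : ℝ) (v ξ : Idx k → ℝ) :
    futureSign v (c • ξ) = c * futureSign v ξ := by
  simp only [futureSign, Pi.smul_apply, smul_eq_mul]
  ring

/-- If the sign vanishes, the $(u,t)$-parts of $\xi$ and $v$ are proportional, so some $\xi-cv$ is
purely spacelike. Its norm is $c^2\ge0$ and also $\le0$, which forces $c=0$ and then $\xi=0$. -/
theorem eq_zero_of_futureSign {k : ℕ} {v ξ : Idx k → ℝ} (hv : form v v = 1) (hξ : form ξ ξ = 0)
    (h : form v ξ = 0) (hf : futureSign v ξ = 0) : ξ = 0 := by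
  have hD : 0 < v (Sum.inl 0) ^ 2 + v (Sum.inl 1) ^ 2 := by
    have hs : 0 ≤ ∑ i, v (Sum.inr i) * v (Sum.inr i) :=
      Finset.sum_nonneg fun i _ => mul_self_nonneg _
    rw [form_eq_sum] at hv
    nlinarith
  obtain ⟨c, hc⟩ : ∃ c, c = (v (Sum.inl 0) * ξ (Sum.inl 0) + v (Sum.inl 1) * ξ (Sum.inl 1)) /
    (v (Sum.inl 0) ^ 2 + v (Sum.inl 1) ^ 2) := ⟨_, rfl⟩
  rw [eq_div_iff hD.ne'] at hc
  rw [futureSign] at hf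
  have h0 : ξ (Sum.inl 0) = c * v (Sum.inl 0) := by
    refine mul_right_cancel₀ hD.ne' ?_
    linear_combination -v (Sum.inl 0) * hc - v (Sum.inl 1) * hf
  have h1 : ξ (Sum.inl 1) = c * v (Sum.inl 1) := by
    refine mul_right_cancel₀ hD.ne' ?_
    linear_combination -v (Sum.inl 1) * hc + v (Sum.inl 0) * hf
  have hq : form (ξ - c • v) (ξ - c • v) = c ^ 2 := by
    simp only [form_sub_left, form_sub_right, form_smul_left, form_smul_right, hv, hξ, h,
      form_comm ξ v]
    ring
  have hsum : 0 ≤ ∑ i, (ξ - c • v) (Sum.inr i) * (ξ - c • v) (Sum.inr i) :=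
    Finset.sum_nonneg fun i _ => mul_self_nonneg _
  have hq' := hq
  rw [form_eq_sum] at hq'
  simp only [Pi.sub_apply, Pi.smul_apply, smul_eq_mul, h0, h1, sub_self, mul_zero, zero_add,
    zero_sub] at hq' hsum
  have hc0 : c = 0 := by
    have : c ^ 2 = 0 := le_antisymm (by linarith) (sq_nonneg c)
    exact pow_eq_zero_iff two_ne_zero |>.1 this
  subst hc0
  have hz : ∑ i, ξ (Sum.inr i) * ξ (Sum.inr i) = 0 := by simpa using hq'
  rw [Finset.sum_eq_zero_iff_of_nonneg fun i _ => mul_self_nonneg _] at hz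
  ext i
  rcases i with i | i
  · fin_cases i
    · simpa using h0
    · simpa using h1
  · exact mul_self_eq_zero.1 (hz i (Finset.mem_univ i))

/-- The sign never vanishes on the connected group $G$ and is positive at the identity. -/
theorem futureSign_pos {k : ℕ} (g : G k) {w : Fin (k + 2) → ℝ} (hw : ∑ i, w i ^ 2 = 1) :
    0 < futureSign (mat g *ᵥ baseVec k) (mat g *ᵥ nullVec w) := by
  have hne : ∀ g : G k, futureSign (mat g *ᵥ baseVec k) (mat g *ᵥ nullVec w) ≠ 0 := by
    intro g hg
    have h := eq_zero_of_futureSign (by rw [form_mulVec, form_baseVec])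
      (by rw [form_mulVec, form_nullVec_self hw])
      (by rw [form_mulVec, form_baseVec_left]; rfl) hg
    have h2 := congrArg (fun z => (mat g⁻¹ *ᵥ z) (Sum.inl 1)) h
    simp only [mat_inv_mulVec_mulVec, mulVec_zero] at h2
    simp [nullVec] at h2
  have hcont : Continuous fun g : G k =>
      futureSign (mat g *ᵥ baseVec k) (mat g *ᵥ nullVec w) := by
    have h1 : ∀ v : Idx k → ℝ, ∀ i, Continuous fun g : G k => (mat g *ᵥ v) i := fun v i =>
      (continuous_apply i).comp (continuous_mat.matrix_mulVec continuous_const)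
    exact ((h1 _ _).mul (h1 _ _)).sub ((h1 _ _).mul (h1 _ _))
  by_contra! hneg
  have h1 : (0 : ℝ) ≤ futureSign (mat (1 : G k) *ᵥ baseVec k) (mat (1 : G k) *ᵥ nullVec w) := by
    simp [mat_one, futureSign, baseVec, nullVec]
  obtain ⟨g', hg'⟩ := mem_range_of_exists_le_of_exists_ge hcont ⟨g, hneg⟩ ⟨1, h1⟩
  exact hne g' hg'

theorem exists_eq_smul_nullVec {k : ℕ} (g : G k) {ξ : Idx k → ℝ} (hξ : form ξ ξ = 0)
    (h : form (mat g *ᵥ baseVec k) ξ = 0) (hf : 0 < futureSign (mat g *ᵥ baseVec k) ξ) :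
    ∃ c : ℝ, 0 < c ∧ ∃ w : Fin (k + 2) → ℝ, ∑ i, w i ^ 2 = 1 ∧ ξ = c • (mat g *ᵥ nullVec w) := by
  obtain ⟨ζ, rfl⟩ : ∃ ζ, ξ = mat g *ᵥ ζ := ⟨mat g⁻¹ *ᵥ ξ, (mat_mulVec_inv_mulVec g ξ).symm⟩
  rw [form_mulVec] at hξ h
  rw [form_baseVec_left] at h
  rw [form_eq_sum, h] at hξ
  have hτ : ζ (Sum.inl 1) ≠ 0 := by
    intro h1
    rw [h1] at hξ
    have hz : ∑ i, ζ (Sum.inr i) * ζ (Sum.inr i) = 0 := by linarith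
    rw [Finset.sum_eq_zero_iff_of_nonneg fun i _ => mul_self_nonneg _] at hz
    have h0 : ζ = 0 := by
      ext i
      rcases i with i | i
      · fin_cases i
        · exact h
        · exact h1
      · exact mul_self_eq_zero.1 (hz i (Finset.mem_univ i))
    simp [h0, futureSign] at hf
  obtain ⟨w, hwdef⟩ : ∃ w : Fin (k + 2) → ℝ, w = fun i => ζ (Sum.inr i) / ζ (Sum.inl 1) := ⟨_, rfl⟩
  have hw : ∑ i, w i ^ 2 = 1 := by
    simp only [hwdef, div_pow, ← Finset.sum_div]
    rw [div_eq_one_iff_eq (pow_ne_zero 2 hτ)]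
    simp only [pow_two]
    linarith
  have hζ : ζ = ζ (Sum.inl 1) • nullVec w := by
    ext i
    rcases i with i | i
    · fin_cases i
      · simp [nullVec, h]
      · simp [nullVec]
    · simp [nullVec, hwdef, mul_div_cancel₀, hτ]
  rw [hζ, mulVec_smul, futureSign_smul] at hf
  exact ⟨ζ (Sum.inl 1), pos_of_mul_pos_left hf (futureSign_pos g hw).le, w, hw,
    by rw [← mulVec_smul, ← hζ]⟩

/-- The product `(t - x₂) (t + x₂)`, whose zeros are the singularity. -/
def sing {k : ℕ} (v : Idx k → ℝ) : ℝ :=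
  (v (Sum.inl 1) - v (Sum.inr 1)) * (v (Sum.inl 1) + v (Sum.inr 1))

/-- Future null tangent vectors are the positive multiples of the vectors $g(e_t+w)$, and rescaling
$\xi$ only rescales the parameter $s$ of the ray. -/
theorem mem_BlackHole_iff_forall {k : ℕ} (p : AdS k) : p ∈ BlackHole k ↔
    ∀ ξ, form ξ ξ = 0 → form (pt p) ξ = 0 → 0 < futureSign (pt p) ξ →
      ∃ s : ℝ, 0 < s ∧ sing (pt p + s • ξ) = 0 := by
  constructor
  · intro hp ξ hξ h hf
    obtain ⟨g, rfl⟩ := QuotientGroup.mk_surjective p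
    obtain ⟨c, hc, w, hw, rfl⟩ := exists_eq_smul_nullVec g hξ h hf
    obtain ⟨s, hs, hS⟩ := hp g rfl w hw
    rw [mem_Singularity_iff, pt_geodesic g hw] at hS
    refine ⟨s / c, div_pos hs hc, ?_⟩
    rw [smul_smul, div_mul_cancel₀ _ hc.ne']
    exact hS
  · rintro h g rfl w hw
    obtain ⟨s, hs, hS⟩ := h (mat g *ᵥ nullVec w) (by rw [form_mulVec, form_nullVec_self hw])
      (by rw [pt_proj, form_mulVec, form_baseVec_left]; rfl) (futureSign_pos g hw)
    exact ⟨s, hs, by rw [mem_Singularity_iff, pt_geodesic g hw]; exact hS⟩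

theorem FreePart_eq_compl (k : ℕ) : FreePart k = (BlackHole k)ᶜ := by
  ext p
  simp only [FreePart, BlackHole, Set.mem_compl_iff, Set.mem_ofPred_eq]
  push Not
  rfl

/-! ### The black hole -/

theorem mul_nonneg_of_forall_add_mul_ne_zero {a α : ℝ} (h : ∀ s : ℝ, 0 < s → a + s * α ≠ 0) :
    0 ≤ a * α := by
  by_contra! hneg
  have hα : α ≠ 0 := right_ne_zero_of_mul hneg.ne
  refine h (-a / α) ?_ (by field_simp; ring)
  rw [show -a / α = -(a * α) / (α * α) by field_simp]
  exact div_pos (neg_pos.2 hneg) (mul_self_pos.2 hα)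

theorem add_mul_ne_zero_of_mul_nonneg {a α s : ℝ} (hs : 0 < s) (h : 0 ≤ a * α)
    (h0 : a ≠ 0 ∨ α ≠ 0) : a + s * α ≠ 0 := by
  intro h1
  have ha : a = -(s * α) := by linarith
  have hα : α = 0 := by
    rw [ha] at h
    by_contra hne
    have := mul_pos hs (mul_self_pos.2 hne)
    nlinarith
  subst hα
  simp at ha
  simp [ha] at h0

/-- The light-like directions at a point of the black hole with positive `t - x₂` and `t + x₂`. -/
theorem not_escape_aux {u a b α β e S Y N : ℝ} (hSYN : S ^ 2 ≤ Y * N) (hv : a * b + u ^ 2 - Y = 1)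
    (hξ : α * β + e ^ 2 - N = 0) (h : u * e + (a * β + b * α) / 2 - S = 0)
    (hf : 0 < u * (α + β) - (a + b) * e) (ha : 0 < a) (hb : 0 < b) (hab : a * b < 1) (hu : u < 0)
    (hα : 0 ≤ α) (hβ : 0 ≤ β) : False := by
  obtain ⟨U, rfl⟩ : ∃ U, u = -U := ⟨-u, by ring⟩
  obtain ⟨f, rfl⟩ : ∃ f, e = -f := ⟨-e, by ring⟩
  have hU : 0 < U := by linarith
  have hff : U * (α + β) < (a + b) * f := by linarith
  have hf0 : 0 < f := by
    have : 0 ≤ U * (α + β) := by positivity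
    exact pos_of_mul_pos_right (this.trans_lt hff) (by positivity)
  have hS : S = U * f + (a * β + b * α) / 2 := by linarith
  have hY : Y = U ^ 2 - (1 - a * b) := by linarith
  have hN : N = α * β + f ^ 2 := by linarith
  rw [hS, hY, hN] at hSYN
  -- This is Cauchy-Schwarz after eliminating $S,Y,N$. The future condition, multiplied by
  -- $U(a\beta+b\alpha)$, bounds the right side by the first term on the left, contradicting the
  -- positivity of $(1-ab)(\alpha\beta+f^2)$.
  have h1 : U * f * (a * β + b * α) + ((a * β + b * α) / 2) ^ 2 +
      (1 - a * b) * (α * β + f ^ 2) ≤ U ^ 2 * (α * β) := by linarith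
  have h2 : U ^ 2 * (α * β) * (a + b) ≤ U * f * (a * β + b * α) * (a + b) := by
    have h3 : U * (α + β) * (U * (a * β + b * α)) ≤ (a + b) * f * (U * (a * β + b * α)) :=
      mul_le_mul_of_nonneg_right hff.le (by positivity)
    have h4 : 0 ≤ U ^ 2 * (b * α ^ 2 + a * β ^ 2) := by positivity
    linarith
  have h5 := le_of_mul_le_mul_right h2 (add_pos ha hb)
  have h6 : 0 < (1 - a * b) * (α * β + f ^ 2) := mul_pos (by linarith) (by positivity)
  have h7 : 0 ≤ ((a * β + b * α) / 2) ^ 2 := sq_nonneg _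
  linarith

theorem not_escape {u a b α β e S Y N : ℝ} (hSYN : S ^ 2 ≤ Y * N) (hv : a * b + u ^ 2 - Y = 1)
    (hξ : α * β + e ^ 2 - N = 0) (h : u * e + (a * β + b * α) / 2 - S = 0)
    (hf : 0 < u * (α + β) - (a + b) * e) (hab0 : 0 < a * b) (hab : a * b < 1)
    (hu : u * (a + b) < 0) (hα : 0 ≤ a * α) (hβ : 0 ≤ b * β) : False := by
  rcases pos_and_pos_or_neg_and_neg_of_mul_pos hab0 with ⟨ha, hb⟩ | ⟨ha, hb⟩
  · exact not_escape_aux hSYN hv hξ h hf ha hb hab (neg_of_mul_neg_left hu (by linarith))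
      (nonneg_of_mul_nonneg_right hα ha) (nonneg_of_mul_nonneg_right hβ hb)
  -- The symmetry $(v,\xi)\mapsto(-v,-\xi)$ preserves every hypothesis.
  · refine not_escape_aux (u := -u) (a := -a) (b := -b) (α := -α) (β := -β) (e := -e) hSYN
      (by linarith) (by linarith) (by linarith) (by linarith) (by linarith) (by linarith)
      (by linarith) ?_ ?_ ?_
    · have : 0 < u := by
        by_contra! hu0
        nlinarith
      linarith
    · exact nonneg_of_mul_nonneg_right (a := -a) (by linarith) (by linarith)
    · exact nonneg_of_mul_nonneg_right (a := -b) (by linarith) (by linarith)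

/-- The conditions `0 < t² - x₂² < 1` and `u t < 0`. -/
def Region {k : ℕ} (v : Idx k → ℝ) : Prop :=
  0 < sing v ∧ sing v < 1 ∧ v (Sum.inl 0) * v (Sum.inl 1) < 0

theorem exists_sing_eq_zero {k : ℕ} {v ξ : Idx k → ℝ} (hv : form v v = 1) (hR : Region v)
    (hξ : form ξ ξ = 0) (h : form v ξ = 0) (hf : 0 < futureSign v ξ) :
    ∃ s : ℝ, 0 < s ∧ sing (v + s • ξ) = 0 := by
  by_contra! hno
  obtain ⟨h0, h1, hu⟩ := hR
  -- `Option (Fin k)` indexes the spacelike coordinates other than $x_2$: `none` is $x_1$.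
  have hcs := Finset.sum_mul_sq_le_sq_mul_sq (Finset.univ : Finset (Option (Fin k)))
    (fun i => i.elim (v (Sum.inr 0)) fun j => v (Sum.inr j.succ.succ))
    (fun i => i.elim (ξ (Sum.inr 0)) fun j => ξ (Sum.inr j.succ.succ))
  simp only [Fintype.sum_option, Option.elim_none, Option.elim_some] at hcs
  rw [sing] at h0 h1
  rw [futureSign] at hf
  rw [form_apply] at hv hξ h
  simp only [← pow_two] at hv hξ
  simp only [sing, Pi.add_apply, Pi.smul_apply, smul_eq_mul] at hno
  refine not_escape (u := v (Sum.inl 0)) (a := v (Sum.inl 1) - v (Sum.inr 1))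
    (b := v (Sum.inl 1) + v (Sum.inr 1)) (α := ξ (Sum.inl 1) - ξ (Sum.inr 1))
    (β := ξ (Sum.inl 1) + ξ (Sum.inr 1)) (e := ξ (Sum.inl 0)) hcs
    (by linarith) (by linarith) (by linarith) (by linarith) h0 h1 (by linarith) ?_ ?_
  · refine mul_nonneg_of_forall_add_mul_ne_zero fun s hs hz => ?_
    exact left_ne_zero_of_mul (hno s hs) (by linarith)
  · refine mul_nonneg_of_forall_add_mul_ne_zero fun s hs hz => ?_
    exact right_ne_zero_of_mul (hno s hs) (by linarith)

/-- A future light-like direction at `v` which never reaches the singularity. -/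
def Escapes {k : ℕ} (v ξ : Idx k → ℝ) : Prop :=
  form ξ ξ = 0 ∧ form v ξ = 0 ∧ 0 < futureSign v ξ ∧ ∀ s : ℝ, 0 < s → sing (v + s • ξ) ≠ 0

theorem sing_ne_zero {k : ℕ} {v ξ : Idx k → ℝ}
    (ha : 0 ≤ (v (Sum.inl 1) - v (Sum.inr 1)) * (ξ (Sum.inl 1) - ξ (Sum.inr 1)))
    (ha' : v (Sum.inl 1) - v (Sum.inr 1) ≠ 0 ∨ ξ (Sum.inl 1) - ξ (Sum.inr 1) ≠ 0)
    (hb : 0 ≤ (v (Sum.inl 1) + v (Sum.inr 1)) * (ξ (Sum.inl 1) + ξ (Sum.inr 1)))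
    (hb' : v (Sum.inl 1) + v (Sum.inr 1) ≠ 0 ∨ ξ (Sum.inl 1) + ξ (Sum.inr 1) ≠ 0)
    (s : ℝ) (hs : 0 < s) : sing (v + s • ξ) ≠ 0 := by
  have h1 := add_mul_ne_zero_of_mul_nonneg hs ha ha'
  have h2 := add_mul_ne_zero_of_mul_nonneg hs hb hb'
  convert mul_ne_zero h1 h2 using 1
  simp only [sing, Pi.add_apply, Pi.smul_apply, smul_eq_mul]
  ring

/-- The tangent vector at `v` in an isotropic plane. -/
def planeVec {k : ℕ} (δ ε : ℝ) (v : Idx k → ℝ) : Idx k → ℝ :=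
  form (mvec k ε) v • lvec k δ - form (lvec k δ) v • mvec k ε

theorem form_planeVec_self {k : ℕ} {δ ε : ℝ} (hδ : δ * δ = 1) (hε : ε * ε = 1) (v : Idx k → ℝ) :
    form (planeVec δ ε v) (planeVec δ ε v) = 0 := by
  simp only [planeVec, form_sub_left, form_sub_right, form_smul_left, form_smul_right,
    lvec_null hδ, mvec_null hε, form_lvec_mvec, form_comm (mvec k ε) (lvec k δ)]
  ring

theorem form_planeVec {k : ℕ} (δ ε : ℝ) (v : Idx k → ℝ) : form v (planeVec δ ε v) = 0 := by
  rw [planeVec, form_sub_right, form_smul_right, form_smul_right, form_comm v, form_comm v]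
  ring

theorem planeVec_inl_zero {k : ℕ} (δ ε : ℝ) (v : Idx k → ℝ) :
    planeVec δ ε v (Sum.inl 0) = -(v (Sum.inl 1) - δ * v (Sum.inr 1)) := by
  rw [planeVec, form_lvec, form_mvec]
  simp [lvec, mvec]

theorem planeVec_inl_one {k : ℕ} (δ ε : ℝ) (v : Idx k → ℝ) :
    planeVec δ ε v (Sum.inl 1) = v (Sum.inl 0) - ε * v (Sum.inr 0) := by
  rw [planeVec, form_lvec, form_mvec]
  simp [lvec, mvec]

theorem planeVec_inr_one {k : ℕ} (δ ε : ℝ) (v : Idx k → ℝ) :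
    planeVec δ ε v (Sum.inr 1) = δ * (v (Sum.inl 0) - ε * v (Sum.inr 0)) := by
  rw [planeVec, form_lvec, form_mvec]
  simp [lvec, mvec, mul_comm]

theorem futureSign_planeVec {k : ℕ} (δ ε : ℝ) (v : Idx k → ℝ) : futureSign v (planeVec δ ε v) =
    v (Sum.inl 0) * (v (Sum.inl 0) - ε * v (Sum.inr 0)) +
      v (Sum.inl 1) * (v (Sum.inl 1) - δ * v (Sum.inr 1)) := by
  rw [futureSign, planeVec_inl_zero, planeVec_inl_one]
  ring

/-- Along this ray $t-x_2$ is constant, and $t+x_2$ moves with velocity $2(u-\varepsilon x_1)$; only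
the sign of the latter matters. -/
theorem escapes_planeVec_one {k : ℕ} {ε : ℝ} (hε : ε * ε = 1) {v : Idx k → ℝ}
    (hf : 0 < futureSign v (planeVec 1 ε v)) (ha : v (Sum.inl 1) - v (Sum.inr 1) ≠ 0)
    (hb : 0 ≤ (v (Sum.inl 1) + v (Sum.inr 1)) * (v (Sum.inl 0) - ε * v (Sum.inr 0)))
    (hb' : v (Sum.inl 1) + v (Sum.inr 1) ≠ 0 ∨ v (Sum.inl 0) - ε * v (Sum.inr 0) ≠ 0) :
    Escapes v (planeVec 1 ε v) := by
  refine ⟨form_planeVec_self (by norm_num) hε v, form_planeVec 1 ε v, hf, sing_ne_zero ?_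
    (Or.inl ha) ?_ ?_⟩
  · rw [planeVec_inl_one, planeVec_inr_one, one_mul, sub_self, mul_zero]
  · rw [planeVec_inl_one, planeVec_inr_one]
    linarith
  · rw [planeVec_inl_one, planeVec_inr_one, one_mul, ← two_mul]
    exact hb'.imp_right (mul_ne_zero two_ne_zero)

theorem escapes_planeVec_neg_one {k : ℕ} {ε : ℝ} (hε : ε * ε = 1) {v : Idx k → ℝ}
    (hf : 0 < futureSign v (planeVec (-1) ε v)) (hb : v (Sum.inl 1) + v (Sum.inr 1) ≠ 0)
    (ha : 0 ≤ (v (Sum.inl 1) - v (Sum.inr 1)) * (v (Sum.inl 0) - ε * v (Sum.inr 0)))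
    (ha' : v (Sum.inl 1) - v (Sum.inr 1) ≠ 0 ∨ v (Sum.inl 0) - ε * v (Sum.inr 0) ≠ 0) :
    Escapes v (planeVec (-1) ε v) := by
  refine ⟨form_planeVec_self (by norm_num) hε v, form_planeVec (-1) ε v, hf, sing_ne_zero ?_ ?_
    ?_ (Or.inl hb)⟩
  · rw [planeVec_inl_one, planeVec_inr_one]
    linarith
  · rw [planeVec_inl_one, planeVec_inr_one, neg_one_mul, sub_neg_eq_add, ← two_mul]
    exact ha'.imp_right (mul_ne_zero two_ne_zero)
  · rw [planeVec_inl_one, planeVec_inr_one]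
    simp

/-! ### Escaping rays at points outside the region. -/

theorem sing_add_sq_sub_sq {k : ℕ} {v : Idx k → ℝ} (hv : form v v = 1) :
    1 ≤ sing v + v (Sum.inl 0) ^ 2 - v (Sum.inr 0) ^ 2 := by
  have hs : 0 ≤ ∑ i : Fin k, v (Sum.inr i.succ.succ) * v (Sum.inr i.succ.succ) :=
    Finset.sum_nonneg fun i _ => mul_self_nonneg _
  rw [form_apply] at hv
  rw [sing]
  linarith

/-- The orthogonal projection to the plane of the coordinates `t` and `x₂`. -/
def projTX {k : ℕ} (v : Idx k → ℝ) : Idx k → ℝ :=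
  Pi.single (Sum.inl 1) (v (Sum.inl 1)) + Pi.single (Sum.inr 1) (v (Sum.inr 1))

theorem form_projTX {k : ℕ} (v z : Idx k → ℝ) : form (projTX v) z =
    v (Sum.inl 1) * z (Sum.inl 1) - v (Sum.inr 1) * z (Sum.inr 1) := by
  simp [form_apply, projTX, Fin.ext_iff]

theorem exists_escapes_of_one_lt {k : ℕ} {v : Idx k → ℝ} (hv : form v v = 1) (h : 1 < sing v) :
    ∃ ξ, Escapes v ξ := by
  obtain ⟨D, hD⟩ : ∃ D, D = sing v := ⟨_, rfl⟩
  rw [← hD] at h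
  rw [sing] at hD
  have ht : v (Sum.inl 1) ≠ 0 := by
    intro h0
    rw [h0] at hD
    nlinarith [sq_nonneg (v (Sum.inr 1))]
  obtain ⟨r, hr⟩ : ∃ r, r = √(D - 1 + v (Sum.inl 0) ^ 2) := ⟨_, rfl⟩
  have hr2 : r ^ 2 = D - 1 + v (Sum.inl 0) ^ 2 := by
    rw [hr, Real.sq_sqrt (by nlinarith [sq_nonneg (v (Sum.inl 0))])]
  have hr0 : 0 < r := hr ▸ Real.sqrt_pos.2 (by nlinarith [sq_nonneg (v (Sum.inl 0))])
  obtain ⟨κ, hκ2, hκt⟩ : ∃ κ : ℝ, κ ^ 2 = D ∧ 0 < κ * v (Sum.inl 1) := by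
    rcases ht.lt_or_gt with h0 | h0
    · exact ⟨-√D, by rw [neg_sq, Real.sq_sqrt (by linarith)],
        mul_pos_of_neg_of_neg (neg_neg_of_pos (Real.sqrt_pos.2 (by linarith))) h0⟩
    · exact ⟨√D, Real.sq_sqrt (by linarith), mul_pos (Real.sqrt_pos.2 (by linarith)) h0⟩
  have hbase : form v (baseVec k) = v (Sum.inl 0) := by rw [form_comm, form_baseVec_left]
  have hpv : form v (projTX v) = D := by rw [form_comm, form_projTX, hD]; ring
  have hpp : form (projTX v) (projTX v) = D := by
    rw [form_projTX, hD]
    simp [projTX]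
    ring
  have hpb : form (projTX v) (baseVec k) = 0 := by simp [form_projTX, baseVec]
  have hbp : form (baseVec k) (projTX v) = 0 := by rw [form_comm, hpb]
  obtain ⟨u, hu⟩ : ∃ u, u = v (Sum.inl 0) := ⟨_, rfl⟩
  rw [← hu] at hr2 hbase
  -- The coefficients make $\xi\perp v$ and make the $(t,x_2)$-part of $\xi$ equal to $r(D-1)>0$
  -- times that of $v$, so both factors move away from zero. The value of $r^2$ makes $\xi$ null,
  -- and the sign of $\kappa$ makes it future directed.
  obtain ⟨ξ, hξ⟩ : ∃ ξ, ξ = (r * D - κ * u) • v + (-(κ * (D - 1))) • baseVec k +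
    (κ * u - r) • projTX v := ⟨_, rfl⟩
  have hξ0 : ξ (Sum.inl 0) = (r * D - κ * u) * u - κ * (D - 1) := by
    rw [hξ, hu]
    simp [baseVec, projTX]
    ring
  have hξ1 : ξ (Sum.inl 1) = r * (D - 1) * v (Sum.inl 1) := by
    rw [hξ]
    simp [baseVec, projTX]
    ring
  have hξ2 : ξ (Sum.inr 1) = r * (D - 1) * v (Sum.inr 1) := by
    rw [hξ]
    simp [baseVec, projTX]
    ring
  have hab : (v (Sum.inl 1) - v (Sum.inr 1)) * (v (Sum.inl 1) + v (Sum.inr 1)) ≠ 0 := by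
    rw [← hD]
    linarith
  have hrD : 0 < r * (D - 1) := mul_pos hr0 (by linarith)
  refine ⟨ξ, ?_, ?_, ?_, sing_ne_zero ?_ (Or.inl (left_ne_zero_of_mul hab)) ?_
    (Or.inl (right_ne_zero_of_mul hab))⟩
  · rw [hξ]
    simp only [form_add_left, form_add_right, form_smul_left, form_smul_right, hv, hbase, hpv,
      form_baseVec, hpp, hpb, hbp, form_comm (baseVec k) v, form_comm (projTX v) v]
    rw [← hκ2] at hr2 ⊢
    linear_combination -(κ ^ 2 * (κ ^ 2 - 1)) * hr2
  · rw [hξ]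
    simp only [form_add_right, form_smul_right, hv, hbase, hpv]
    ring
  · have hkey : 0 < v (Sum.inl 1) * (κ * r - u) := by
      have h1 : u ^ 2 < (κ * r) ^ 2 := by
        rw [mul_pow, hκ2, hr2]
        nlinarith [sq_nonneg u]
      have h2 : (v (Sum.inl 1) * u) ^ 2 < (κ * v (Sum.inl 1) * r) ^ 2 := by
        have := mul_lt_mul_of_pos_left h1 (pow_pos (abs_pos.2 ht) 2)
        rw [sq_abs] at this
        linarith
      have h3 := abs_lt_of_sq_lt_sq h2 (by positivity)
      have h4 := (abs_lt.1 h3).2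
      linarith
    rw [futureSign, hξ0, hξ1, ← hu]
    have h5 := mul_pos hr0 hkey
    linear_combination h5 + v (Sum.inl 1) * κ * hr2
  · rw [hξ1, hξ2, ← mul_sub, mul_left_comm]
    exact mul_nonneg hrD.le (mul_self_nonneg _)
  · rw [hξ1, hξ2, ← mul_add, mul_left_comm]
    exact mul_nonneg hrD.le (mul_self_nonneg _)

theorem exists_escapes_of_eq_one {k : ℕ} {v : Idx k → ℝ} (hv : form v v = 1) (h : sing v = 1) :
    ∃ ξ, Escapes v ξ := by
  have hsing := h
  rw [sing] at h
  have hab : (v (Sum.inl 1) - v (Sum.inr 1)) * (v (Sum.inl 1) + v (Sum.inr 1)) ≠ 0 := by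
    rw [h]
    exact one_ne_zero
  have ht : 0 < v (Sum.inl 1) ^ 2 := by nlinarith [sq_nonneg (v (Sum.inr 1))]
  by_cases hu : v (Sum.inl 0) = 0
  · have hx : v (Sum.inr 0) = 0 := by
      have := sing_add_sq_sub_sq hv
      rw [hsing, hu] at this
      have : v (Sum.inr 0) ^ 2 = 0 := le_antisymm (by linarith) (sq_nonneg _)
      exact (pow_eq_zero_iff two_ne_zero).1 this
    have e1 : (mvec k 1 : Idx k → ℝ) (Sum.inl 1) = 0 := by simp [mvec]
    have e2 : (mvec k 1 : Idx k → ℝ) (Sum.inr 1) = 0 := by simp [mvec]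
    have e3 : (mvec k 1 : Idx k → ℝ) (Sum.inl 0) = 1 := by simp [mvec]
    refine ⟨-v (Sum.inl 1) • mvec k 1, ?_, ?_, ?_, sing_ne_zero ?_ (Or.inl (left_ne_zero_of_mul hab))
      ?_ (Or.inl (right_ne_zero_of_mul hab))⟩
    · rw [form_smul_left, form_smul_right, mvec_null (by norm_num), mul_zero, mul_zero]
    · rw [form_smul_right, form_comm, form_mvec, hu, hx]
      ring
    · rw [futureSign_smul, futureSign, e1, e3]
      linarith
    · simp [e1, e2]
    · simp [e1, e2]
  · have hpv : form v (projTX v) = 1 := by rw [form_comm, form_projTX, ← h]; ring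
    have hpp : form (projTX v) (projTX v) = 1 := by
      rw [form_projTX, ← h]
      simp [projTX]
      ring
    have e1 : (v - projTX v) (Sum.inl 1) = 0 := by simp [projTX]
    have e2 : (v - projTX v) (Sum.inr 1) = 0 := by simp [projTX]
    have e3 : (v - projTX v) (Sum.inl 0) = v (Sum.inl 0) := by simp [projTX]
    -- When $t^2-x_2^2=1$, removing the $(t,x_2)$-part of $v$ leaves a null tangent vector, along
    -- which $t$ and $x_2$ are constant. The factor $-tu$ turns it to the future.
    refine ⟨(-(v (Sum.inl 1) * v (Sum.inl 0))) • (v - projTX v), ?_, ?_, ?_, sing_ne_zero ?_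
      (Or.inl (left_ne_zero_of_mul hab)) ?_ (Or.inl (right_ne_zero_of_mul hab))⟩
    · rw [form_smul_left, form_smul_right, form_sub_left, form_sub_right, form_sub_right, hv, hpv,
        hpp, form_comm (projTX v), hpv]
      ring
    · rw [form_smul_right, form_sub_right, hv, hpv, sub_self, mul_zero]
    · rw [futureSign_smul, futureSign, e1, e3]
      have := mul_pos ht (pow_pos (abs_pos.2 hu) 2)
      rw [sq_abs] at this
      linarith
    · simp only [Pi.smul_apply, smul_eq_mul, e1, e2]
      simp
    · simp only [Pi.smul_apply, smul_eq_mul, e1, e2]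
      simp

theorem exists_escapes_of_eq_zero {k : ℕ} {v : Idx k → ℝ} (hv : form v v = 1)
    (ha : v (Sum.inl 1) - v (Sum.inr 1) = 0) (hb : v (Sum.inl 1) + v (Sum.inr 1) = 0) :
    ∃ ξ, Escapes v ξ := by
  have ht : v (Sum.inl 1) = 0 := by linarith
  have hx : v (Sum.inr 1) = 0 := by linarith
  have hux := sing_add_sq_sub_sq hv
  rw [sing, ha, zero_mul, zero_add] at hux
  have hu : v (Sum.inl 0) ≠ 0 := by
    intro h0
    rw [h0] at hux
    nlinarith [sq_nonneg (v (Sum.inr 0))]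
  have hpos : 0 < v (Sum.inl 0) ^ 2 - v (Sum.inr 0) ^ 2 := by linarith
  obtain ⟨τ, hτ, hτu⟩ : ∃ τ : ℝ, τ ^ 2 = v (Sum.inl 0) ^ 2 - v (Sum.inr 0) ^ 2 ∧
      0 < v (Sum.inl 0) * τ := by
    rcases hu.lt_or_gt with h0 | h0
    · exact ⟨-√(v (Sum.inl 0) ^ 2 - v (Sum.inr 0) ^ 2), by rw [neg_sq, Real.sq_sqrt hpos.le],
        mul_pos_of_neg_of_neg h0 (neg_neg_of_pos (Real.sqrt_pos.2 hpos))⟩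
    · exact ⟨√(v (Sum.inl 0) ^ 2 - v (Sum.inr 0) ^ 2), Real.sq_sqrt hpos.le,
        mul_pos h0 (Real.sqrt_pos.2 hpos)⟩
  -- At $t=x_2=0$ both factors equal $s\tau$ along this ray, so they leave zero at once.
  obtain ⟨ξ, hξ⟩ : ∃ ξ : Idx k → ℝ, ξ = Pi.single (Sum.inl 0) (v (Sum.inr 0)) +
    Pi.single (Sum.inl 1) τ + Pi.single (Sum.inr 0) (v (Sum.inl 0)) := ⟨_, rfl⟩
  have hform : ∀ z, form z ξ = z (Sum.inl 0) * v (Sum.inr 0) + z (Sum.inl 1) * τ -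
      z (Sum.inr 0) * v (Sum.inl 0) := by
    intro z
    rw [hξ]
    simp [form_apply, Fin.ext_iff]
  have e0 : ξ (Sum.inl 0) = v (Sum.inr 0) := by simp [hξ]
  have e1 : ξ (Sum.inl 1) = τ := by simp [hξ]
  have e2 : ξ (Sum.inr 0) = v (Sum.inl 0) := by simp [hξ]
  have e3 : ξ (Sum.inr 1) = 0 := by simp [hξ]
  have hτ0 : τ ≠ 0 := right_ne_zero_of_mul hτu.ne'
  refine ⟨ξ, ?_, ?_, ?_, sing_ne_zero ?_ (Or.inr ?_) ?_ (Or.inr ?_)⟩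
  · rw [hform, e0, e1, e2]
    linarith
  · rw [hform, ht]
    ring
  · rw [futureSign, e1, ht]
    linarith
  · rw [ha, zero_mul]
  · rwa [e1, e3, sub_zero]
  · rw [hb, zero_mul]
  · rwa [e1, e3, add_zero]

theorem exists_escapes_of_lt_one {k : ℕ} {v : Idx k → ℝ} (hv : form v v = 1) (h : sing v < 1)
    (hR : ¬ Region v) : ∃ ξ, Escapes v ξ := by
  have hux := sing_add_sq_sub_sq hv
  have hux' : v (Sum.inr 0) ^ 2 < v (Sum.inl 0) ^ 2 := by linarith
  have hu : v (Sum.inl 0) ≠ 0 := by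
    intro h0
    rw [h0] at hux'
    nlinarith [sq_nonneg (v (Sum.inr 0))]
  -- With this sign $u-\varepsilon x_1$ has the sign of $u$ and is at least as large in absolute
  -- value.
  obtain ⟨ε, hε, hεx⟩ : ∃ ε : ℝ, ε * ε = 1 ∧ ε * (v (Sum.inl 0) * v (Sum.inr 0)) ≤ 0 := by
    rcases le_total (v (Sum.inl 0) * v (Sum.inr 0)) 0 with h0 | h0
    · exact ⟨1, by norm_num, by linarith⟩
    · exact ⟨-1, by norm_num, by linarith⟩
  have hup : v (Sum.inl 0) ^ 2 ≤ v (Sum.inl 0) * (v (Sum.inl 0) - ε * v (Sum.inr 0)) := by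
    linarith
  have hu2 : 0 < v (Sum.inl 0) ^ 2 := by positivity
  have hq : 1 - sing v ≤ v (Sum.inl 0) ^ 2 := by linarith [sq_nonneg (v (Sum.inr 0))]
  have hp : v (Sum.inl 0) - ε * v (Sum.inr 0) ≠ 0 := by
    intro h0
    rw [h0] at hup
    linarith
  have hsign : ∀ y : ℝ, 0 ≤ y * v (Sum.inl 0) → 0 ≤ y * (v (Sum.inl 0) - ε * v (Sum.inr 0)) := by
    intro y hy
    refine nonneg_of_mul_nonneg_left (b := v (Sum.inl 0) ^ 2) ?_ hu2
    have := mul_nonneg hy (hu2.le.trans hup)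
    linarith
  -- the two planes of the coordinates `(t, x₂)` both give future directed vectors
  have hF : 0 < futureSign v (planeVec 1 ε v) := by
    rw [futureSign_planeVec, one_mul]
    rw [sing] at hq
    -- Half of `hq` completes the square: the sign is at least $\frac12+\frac12(t-x_2)^2$.
    nlinarith [sq_nonneg (v (Sum.inl 1) - v (Sum.inr 1)), sq_nonneg (v (Sum.inl 1)),
      sq_nonneg (v (Sum.inr 1))]
  have hF' : 0 < futureSign v (planeVec (-1) ε v) := by
    rw [futureSign_planeVec, neg_one_mul, sub_neg_eq_add]
    rw [sing] at hq
    nlinarith [sq_nonneg (v (Sum.inl 1) + v (Sum.inr 1)), sq_nonneg (v (Sum.inl 1)),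
      sq_nonneg (v (Sum.inr 1))]
  by_cases ha : v (Sum.inl 1) - v (Sum.inr 1) = 0
  · by_cases hb : v (Sum.inl 1) + v (Sum.inr 1) = 0
    · exact exists_escapes_of_eq_zero hv ha hb
    · exact ⟨_, escapes_planeVec_neg_one hε hF' hb (by rw [ha, zero_mul]) (Or.inr hp)⟩
  · by_cases hb : 0 ≤ (v (Sum.inl 1) + v (Sum.inr 1)) * v (Sum.inl 0)
    · exact ⟨_, escapes_planeVec_one hε hF ha (hsign _ hb) (Or.inr hp)⟩
    · push Not at hb
      refine ⟨_, escapes_planeVec_neg_one hε hF' (left_ne_zero_of_mul hb.ne) (hsign _ ?_)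
        (Or.inr hp)⟩
      -- If both $u(t-x_2)$ and $u(t+x_2)$ are negative, then $t^2-x_2^2>0$ and $ut<0$, so $v$ is in
      -- the region.
      by_contra! hau
      have h0 : 0 < sing v := by
        have := mul_pos_of_neg_of_neg hau hb
        rw [sing]
        refine pos_of_mul_pos_left (b := v (Sum.inl 0) ^ 2) ?_ hu2.le
        linarith
      exact hR ⟨h0, h, by linarith⟩

/-- The black hole is given by the conditions `0 < t² - x₂² < 1` and `u t < 0`. -/
theorem mem_BlackHole_iff {k : ℕ} (p : AdS k) : p ∈ BlackHole k ↔ Region (pt p) := by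
  rw [mem_BlackHole_iff_forall]
  refine ⟨fun h => ?_, fun hR ξ hξ h hf => exists_sing_eq_zero (form_pt p) hR hξ h hf⟩
  by_contra hR
  have hE : ∃ ξ, Escapes (pt p) ξ := by
    rcases lt_trichotomy (sing (pt p)) 1 with h1 | h1 | h1
    · exact exists_escapes_of_lt_one (form_pt p) h1 hR
    · exact exists_escapes_of_eq_one (form_pt p) h1
    · exact exists_escapes_of_one_lt (form_pt p) h1
  obtain ⟨ξ, hξ, h1, hf, hs⟩ := hE
  obtain ⟨s, hs0, hs1⟩ := h ξ hξ h1 hf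
  exact hs s hs0 hs1

open Filter Topology

/-! ### The horizon -/

/-- The conditions `0 ≤ t² - x₂² ≤ 1` and `u t ≤ 0`. -/
def ClosedRegion {k : ℕ} (v : Idx k → ℝ) : Prop :=
  0 ≤ sing v ∧ sing v ≤ 1 ∧ v (Sum.inl 0) * v (Sum.inl 1) ≤ 0

theorem continuous_sing_pt {k : ℕ} : Continuous fun p : AdS k => sing (pt p) := by
  have h : ∀ i, Continuous fun p : AdS k => pt p i := fun i => (continuous_apply i).comp continuous_pt
  exact ((h _).sub (h _)).mul ((h _).add (h _))

theorem continuous_ut_pt {k : ℕ} :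
    Continuous fun p : AdS k => pt p (Sum.inl 0) * pt p (Sum.inl 1) := by
  have h : ∀ i, Continuous fun p : AdS k => pt p i := fun i => (continuous_apply i).comp continuous_pt
  exact (h _).mul (h _)

theorem isOpen_BlackHole (k : ℕ) : IsOpen (BlackHole k) := by
  have h : BlackHole k = {p | 0 < sing (pt p)} ∩ ({p | sing (pt p) < 1} ∩
      {p | pt p (Sum.inl 0) * pt p (Sum.inl 1) < 0}) := Set.ext mem_BlackHole_iff
  rw [h]
  exact (isOpen_lt continuous_const continuous_sing_pt).inter
    ((isOpen_lt continuous_sing_pt continuous_const).inter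
      (isOpen_lt continuous_ut_pt continuous_const))

theorem closure_BlackHole_subset (k : ℕ) : closure (BlackHole k) ⊆ {p | ClosedRegion (pt p)} := by
  refine closure_minimal (fun p hp => ?_) ?_
  · obtain ⟨h0, h1, h2⟩ := (mem_BlackHole_iff p).1 hp
    exact ⟨h0.le, h1.le, h2.le⟩
  · exact (isClosed_le continuous_const continuous_sing_pt).inter
      ((isClosed_le continuous_sing_pt continuous_const).inter
        (isClosed_le continuous_ut_pt continuous_const))

/-- A point is in the closure of `T` if some light ray in an isotropic plane enters it. -/
theorem mem_closure_of_planeVec {k : ℕ} {T : Set (AdS k)} {δ ε : ℝ} (hδ : δ * δ = 1)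
    (hε : ε * ε = 1) (p : AdS k) (κ : ℝ)
    (h : ∀ᶠ s : ℝ in 𝓝[>] 0, ∀ q : AdS k,
      pt q = pt p + (s * κ) • planeVec δ ε (pt p) → q ∈ closure T) : p ∈ closure T := by
  -- The points of the ray are realised in $AdS$ by a unipotent one-parameter group acting on $p$;
  -- no surjectivity of `pt` onto the quadric is needed.
  have hc : Continuous fun s : ℝ => expG ((s * κ) • wedge (mvec k ε) (lvec k δ)) • p := by
    have hX : Continuous fun s : ℝ => (s * κ) • wedge (mvec k ε) (lvec k δ) :=
      Continuous.subtype_mk ((continuous_id.mul continuous_const).smul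
        (continuous_const (y := (wedge (mvec k ε) (lvec k δ)).1))) _
    exact (continuous_expG.comp hX).smul continuous_const
  have h0 := hc.tendsto 0
  have h1 : expG (((0 : ℝ) * κ) • wedge (mvec k ε) (lvec k δ)) • p = p := by
    refine pt_injective ?_
    rw [pt_smul, mat_expG, zero_mul, zero_smul]
    change NormedSpace.exp (0 : Matrix (Idx k) (Idx k) ℝ) *ᵥ pt p = pt p
    rw [NormedSpace.exp_zero, one_mulVec]
  rw [h1] at h0
  refine isClosed_closure.mem_of_tendsto (h0.mono_left nhdsWithin_le_nhds) (h.mono fun s hs => ?_)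
  refine hs _ ?_
  have hml : form (mvec k ε) (lvec k δ) = 0 := by rw [form_comm, form_lvec_mvec]
  rw [pt_smul, ← wedge_smul_right, exp_wedge_mulVec (mvec_null hε)
    (by rw [form_smul_right, hml, mul_zero]), form_smul_left, form_smul_left, form_smul_right,
    lvec_null hδ, planeVec]
  module

/-- There is no quadratic term because one of the two factors is constant along the ray. -/
theorem sing_add_planeVec {k : ℕ} {δ : ℝ} (hδ : δ * δ = 1) (ε c : ℝ) (v : Idx k → ℝ) :
    sing (v + c • planeVec δ ε v) = sing v + 2 * c *
      ((v (Sum.inl 0) - ε * v (Sum.inr 0)) * (v (Sum.inl 1) - δ * v (Sum.inr 1))) := by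
  simp only [sing, Pi.add_apply, Pi.smul_apply, smul_eq_mul, planeVec_inl_one, planeVec_inr_one]
  linear_combination -(c * (v (Sum.inl 0) - ε * v (Sum.inr 0))) ^ 2 * hδ

theorem ut_add_planeVec {k : ℕ} (δ ε c : ℝ) (v : Idx k → ℝ) :
    (v + c • planeVec δ ε v) (Sum.inl 0) * (v + c • planeVec δ ε v) (Sum.inl 1) =
      (v (Sum.inl 0) - c * (v (Sum.inl 1) - δ * v (Sum.inr 1))) *
        (v (Sum.inl 1) + c * (v (Sum.inl 0) - ε * v (Sum.inr 0))) := by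
  simp only [Pi.add_apply, Pi.smul_apply, smul_eq_mul, planeVec_inl_zero, planeVec_inl_one]
  ring

theorem exists_sub_mul_ne_zero {x : ℝ} (hx : x ≠ 0) (y : ℝ) : ∃ ε : ℝ, ε * ε = 1 ∧ x - ε * y ≠ 0 := by
  by_contra! h
  have h1 := h 1 (by norm_num)
  have h2 := h (-1) (by norm_num)
  exact hx (by linarith)

theorem mem_closure_BlackHole_of_neg {k : ℕ} {p : AdS k} (h0 : 0 ≤ sing (pt p))
    (h1 : sing (pt p) ≤ 1) (hut : pt p (Sum.inl 0) * pt p (Sum.inl 1) < 0) :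
    p ∈ closure (BlackHole k) := by
  obtain ⟨ε, hε, hpε⟩ := exists_sub_mul_ne_zero (left_ne_zero_of_mul hut.ne) (pt p (Sum.inr 0))
  obtain ⟨δ, hδ, haδ⟩ := exists_sub_mul_ne_zero (right_ne_zero_of_mul hut.ne) (pt p (Sum.inr 1))
  obtain ⟨c, hc⟩ : ∃ c, c = (pt p (Sum.inl 0) - ε * pt p (Sum.inr 0)) *
    (pt p (Sum.inl 1) - δ * pt p (Sum.inr 1)) := ⟨_, rfl⟩
  have hc2 : 0 < c * c := mul_self_pos.2 (hc ▸ mul_ne_zero hpε haδ)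
  -- With $\sigma=t^2-x_2^2$ and $\tau=2sc^2$, this speed gives the new value
  -- $(1-\tau)\sigma+\tau(1-\sigma)$. It lies strictly between $0$ and $1$ when $\sigma\in[0,1]$ and
  -- $0<\tau<1$.
  refine mem_closure_of_planeVec hδ hε p ((1 - 2 * sing (pt p)) * c) ?_
  have hlt : ∀ᶠ s : ℝ in 𝓝[>] 0, 2 * s * (c * c) < 1 := by
    have hcont : Continuous fun s : ℝ => 2 * s * (c * c) := by fun_prop
    exact nhdsWithin_le_nhds (hcont.continuousAt.eventually_lt continuousAt_const (by simp))
  have hneg : ∀ᶠ s : ℝ in 𝓝[>] 0,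
      (pt p (Sum.inl 0) - s * ((1 - 2 * sing (pt p)) * c) *
        (pt p (Sum.inl 1) - δ * pt p (Sum.inr 1))) *
      (pt p (Sum.inl 1) + s * ((1 - 2 * sing (pt p)) * c) *
        (pt p (Sum.inl 0) - ε * pt p (Sum.inr 0))) < 0 := by
    refine nhdsWithin_le_nhds (ContinuousAt.eventually_lt (Continuous.continuousAt ?_)
      continuousAt_const ?_)
    · fun_prop
    · simpa using hut
  filter_upwards [hlt, hneg, self_mem_nhdsWithin] with s hs1 hs2 hs0 q hq
  have hs : 0 < s * (c * c) := mul_pos hs0 hc2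
  have hsing := sing_add_planeVec hδ ε (s * ((1 - 2 * sing (pt p)) * c)) (pt p)
  rw [← hq, ← hc] at hsing
  refine subset_closure ((mem_BlackHole_iff q).2 ⟨?_, ?_, ?_⟩)
  · rw [hsing]
    by_cases h : sing (pt p) = 0
    · rw [h]
      linarith
    · have := lt_of_le_of_ne h0 (Ne.symm h)
      nlinarith
  · rw [hsing]
    by_cases h : sing (pt p) = 1
    · rw [h]
      linarith
    · have := lt_of_le_of_ne h1 h
      nlinarith
  · rw [hq, ut_add_planeVec]
    exact hs2

theorem mem_closure_BlackHole_of_ClosedRegion {k : ℕ} {p : AdS k} (h : ClosedRegion (pt p)) :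
    p ∈ closure (BlackHole k) := by
  obtain ⟨h0, h1, hut⟩ := h
  rcases hut.lt_or_eq with hut | hut
  · exact mem_closure_BlackHole_of_neg h0 h1 hut
  have hx := sing_add_sq_sub_sq (form_pt p)
  -- If $ut=0$, then $\sigma=t^2-x_2^2$ is $0$ or $1$, and a suitable ray keeps it fixed while
  -- making $ut$ negative. The ray only reaches points already known to be in the closure, hence the
  -- second closure.
  rw [← closure_closure]
  by_cases ht : pt p (Sum.inl 1) = 0
  · have hx2 : pt p (Sum.inr 1) = 0 := by
      rw [sing, ht] at h0
      have : pt p (Sum.inr 1) ^ 2 = 0 := le_antisymm (by linarith) (sq_nonneg _)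
      exact (pow_eq_zero_iff two_ne_zero).1 this
    have hs0 : sing (pt p) = 0 := by rw [sing, ht, hx2]; ring
    have hu : pt p (Sum.inl 0) ≠ 0 := by
      intro hu
      rw [hu, hs0] at hx
      nlinarith [sq_nonneg (pt p (Sum.inr 0))]
    obtain ⟨ε, hε, hpε⟩ := exists_sub_mul_ne_zero hu (pt p (Sum.inr 0))
    refine mem_closure_of_planeVec (δ := 1) (by norm_num) hε p
      (-(pt p (Sum.inl 0) * (pt p (Sum.inl 0) - ε * pt p (Sum.inr 0)))) ?_
    filter_upwards [self_mem_nhdsWithin] with s hs q hq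
    rw [closure_closure]
    have hsing : sing (pt q) = 0 := by
      rw [hq, sing_add_planeVec (by norm_num), ht, hx2, hs0]
      ring
    refine mem_closure_BlackHole_of_neg hsing.ge (hsing.trans_le zero_le_one) ?_
    rw [hq, ut_add_planeVec, ht, hx2]
    have h2 := mul_pos (Set.mem_Ioi.1 hs) (mul_self_pos.2 (mul_ne_zero hu hpε))
    linarith
  · have hu : pt p (Sum.inl 0) = 0 := (mul_eq_zero.1 hut).resolve_right ht
    rw [hu] at hx
    have hs1 : sing (pt p) = 1 := le_antisymm h1 (by linarith [sq_nonneg (pt p (Sum.inr 0))])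
    have hx1 : pt p (Sum.inr 0) = 0 := by
      have : pt p (Sum.inr 0) ^ 2 = 0 := le_antisymm (by linarith) (sq_nonneg _)
      exact (pow_eq_zero_iff two_ne_zero).1 this
    obtain ⟨δ, hδ, haδ⟩ := exists_sub_mul_ne_zero ht (pt p (Sum.inr 1))
    refine mem_closure_of_planeVec (ε := 1) hδ (by norm_num) p
      (pt p (Sum.inl 1) * (pt p (Sum.inl 1) - δ * pt p (Sum.inr 1))) ?_
    filter_upwards [self_mem_nhdsWithin] with s hs q hq
    rw [closure_closure]
    have hsing : sing (pt q) = 1 := by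
      rw [hq, sing_add_planeVec hδ, hu, hx1, hs1]
      ring
    refine mem_closure_BlackHole_of_neg (zero_le_one.trans hsing.ge) hsing.le ?_
    rw [hq, ut_add_planeVec, hu, hx1]
    have h2 := mul_pos (Set.mem_Ioi.1 hs) (mul_self_pos.2 (mul_ne_zero ht haδ))
    linarith

theorem mem_Horizon_iff {k : ℕ} (p : AdS k) :
    p ∈ Horizon k ↔ ClosedRegion (pt p) ∧ ¬ Region (pt p) := by
  rw [Horizon, (isOpen_BlackHole k).frontier_eq, Set.mem_sdiff, mem_BlackHole_iff]
  exact and_congr_left fun _ =>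
    ⟨fun h => closure_BlackHole_subset k h, mem_closure_BlackHole_of_ClosedRegion⟩

/-! ### The inclusion `AdS_l → AdS_{l+1}` and the action of the one-parameter group -/

theorem pt_incl {k : ℕ} (p : AdS k) (i : Idx k) :
    pt (incl k p) (idxEquiv k (Sum.inl i)) = pt p i := by
  obtain ⟨g, rfl⟩ := QuotientGroup.mk_surjective p
  have hb : baseVec (k + 1) = Sum.elim (baseVec k) 0 ∘ (idxEquiv k).symm := by
    ext x
    obtain ⟨y, rfl⟩ := (idxEquiv k).surjective x
    rcases y with (y | y) | y <;> simp [idxEquiv, baseVec, Pi.single_apply]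
  change ((Matrix.fromBlocks (mat g) 0 0 1).submatrix (idxEquiv k).symm
    (idxEquiv k).symm *ᵥ baseVec (k + 1)) _ = (mat g *ᵥ baseVec k) i
  rw [hb, Matrix.submatrix_mulVec_equiv]
  simp [Function.comp_assoc, Matrix.fromBlocks_mulVec]

theorem pt_incl_inl {k : ℕ} (p : AdS k) (i : Fin 2) :
    pt (incl k p) (Sum.inl i) = pt p (Sum.inl i) :=
  pt_incl p (Sum.inl i)

theorem pt_incl_inr_one {k : ℕ} (p : AdS k) : pt (incl k p) (Sum.inr 1) = pt p (Sum.inr 1) :=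
  pt_incl p (Sum.inr 1)

theorem sing_pt_incl {k : ℕ} (p : AdS k) : sing (pt (incl k p)) = sing (pt p) := by
  rw [sing, sing, pt_incl_inl, pt_incl_inr_one]

theorem incl_mem_Singularity_iff {k : ℕ} (p : AdS k) :
    incl k p ∈ Singularity (k + 1) ↔ p ∈ Singularity k := by
  rw [mem_Singularity_iff, mem_Singularity_iff, pt_incl_inl, pt_incl_inr_one]

theorem incl_mem_BlackHole_iff {k : ℕ} (p : AdS k) :
    incl k p ∈ BlackHole (k + 1) ↔ p ∈ BlackHole k := by
  rw [mem_BlackHole_iff, mem_BlackHole_iff, Region, Region, sing_pt_incl, pt_incl_inl, pt_incl_inl]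

theorem incl_mem_FreePart_iff {k : ℕ} (p : AdS k) :
    incl k p ∈ FreePart (k + 1) ↔ p ∈ FreePart k := by
  rw [FreePart_eq_compl, FreePart_eq_compl, Set.mem_compl_iff, Set.mem_compl_iff,
    incl_mem_BlackHole_iff]

/-- A topological boundary need not restrict to a subspace; the explicit inequalities make it do so
here. -/
theorem incl_mem_Horizon_iff {k : ℕ} (p : AdS k) :
    incl k p ∈ Horizon (k + 1) ↔ p ∈ Horizon k := by
  rw [mem_Horizon_iff, mem_Horizon_iff, Region, Region, ClosedRegion, ClosedRegion, sing_pt_incl,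
    pt_incl_inl, pt_incl_inl]

/-! ### Invariance under the one-parameter group. -/

/-- Since $X$ commutes with $J_1$, it preserves the eigenspaces of $J_1$; those for $\pm1$ are
lines. -/
theorem oneParam_mem_lineStabilizer {k : ℕ} {X : so k} (hX : ⁅X, J1 k⁆ = 0) {r : G k}
    (hr : r ∈ oneParam X) {δ : ℝ} (hδ : δ * δ = 1) : r ∈ lineStabilizer (lvec k δ) := by
  obtain ⟨α, rfl⟩ := hr
  have h1 : (⁅X, J1 k⁆ : so k).1 *ᵥ lvec k δ = 0 := by rw [hX]; exact zero_mulVec _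
  rw [lie_mulVec, J1_lvec hδ, mulVec_smul, sub_eq_zero] at h1
  have h2 := eq_smul_lvec_of_J1 hδ h1.symm
  refine ⟨_, (Real.exp_pos _).ne', exp_mulVec_of_eigen (c := α * (X.1 *ᵥ lvec k δ) (Sum.inl 1)) ?_⟩
  rw [so_coe_smul, smul_mulVec, mul_smul, ← h2]

theorem smul_mem_Singularity_iff {k : ℕ} {r : G k} (h1 : r ∈ lineStabilizer (lvec k 1))
    (h2 : r ∈ lineStabilizer (lvec k (-1))) (p : AdS k) :
    r • p ∈ Singularity k ↔ p ∈ Singularity k := by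
  obtain ⟨c, hc, hr⟩ := (lineStabilizer (lvec k 1)).inv_mem h1
  obtain ⟨d, hd, hr'⟩ := (lineStabilizer (lvec k (-1))).inv_mem h2
  have e1 : form (lvec k 1) (pt (r • p)) = c * form (lvec k 1) (pt p) := by
    rw [pt_smul, form_mulVec_right, hr, form_smul_left]
  have e2 : form (lvec k (-1)) (pt (r • p)) = d * form (lvec k (-1)) (pt p) := by
    rw [pt_smul, form_mulVec_right, hr', form_smul_left]
  simp only [form_lvec, one_mul, neg_one_mul, sub_neg_eq_add] at e1 e2
  rw [mem_Singularity_iff, mem_Singularity_iff, e1, e2]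
  simp [hc, hd]

theorem geodesic_mul {k : ℕ} (r g : G k) (w : Fin (k + 2) → ℝ) (s : ℝ) :
    geodesic (r * g) w s = r • geodesic g w s := by
  rw [geodesic, mul_assoc]
  rfl

/-- The light rays issued from $r\cdot p$ are the $r$-translates of those issued from $p$. -/
theorem smul_mem_BlackHole_iff {k : ℕ} {r : G k}
    (h : ∀ p : AdS k, r • p ∈ Singularity k ↔ p ∈ Singularity k) (p : AdS k) :
    r • p ∈ BlackHole k ↔ p ∈ BlackHole k := by
  constructor
  · rintro hp g rfl w hw
    obtain ⟨s, hs, hS⟩ := hp (r * g) rfl w hw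
    exact ⟨s, hs, by rwa [geodesic_mul, h] at hS⟩
  · intro hp g hg w hw
    obtain ⟨s, hs, hS⟩ := hp (r⁻¹ * g) (by
      change r⁻¹ • proj g = p
      rw [hg, inv_smul_smul]) w hw
    refine ⟨s, hs, ?_⟩
    rwa [← h, ← geodesic_mul, mul_inv_cancel_left] at hS

theorem smul_mem_Horizon_iff {k : ℕ} {r : G k}
    (h : ∀ p : AdS k, r • p ∈ BlackHole k ↔ p ∈ BlackHole k) (p : AdS k) :
    r • p ∈ Horizon k ↔ p ∈ Horizon k := by
  have h1 := (Homeomorph.smul r).preimage_frontier (BlackHole k)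
  have h2 : (Homeomorph.smul r : AdS k → AdS k) ⁻¹' BlackHole k = BlackHole k := Set.ext h
  rw [h2] at h1
  exact Set.ext_iff.1 h1 p

theorem oneParam_smul_image_incl {k : ℕ} {X : so (k + 1)} {A : Set (AdS k)} {B : Set (AdS (k + 1))}
    (hR : oneParam X • (incl k '' Set.univ) = Set.univ)
    (hB : ∀ r ∈ oneParam X, ∀ p, r • p ∈ B ↔ p ∈ B) (hA : ∀ p, incl k p ∈ B ↔ p ∈ A) :
    oneParam X • (incl k '' A) = B := by
  ext q
  constructor
  · rintro ⟨r, hr, _, ⟨p, hp, rfl⟩, rfl⟩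
    exact (hB r hr _).2 ((hA p).2 hp)
  · intro hq
    obtain ⟨r, hr, _, ⟨p, -, rfl⟩, rfl⟩ := hR.symm ▸ Set.mem_univ q
    exact ⟨r, hr, _, ⟨p, (hA p).1 ((hB r hr _).1 hq), rfl⟩, rfl⟩

end BTZ

theorem mainTheorem4 (k : ℕ) (X : BTZ.so (k + 1)) (hX : ⁅X, BTZ.J1 (k + 1)⁆ = 0)
    (hR : BTZ.oneParam X • (BTZ.incl k '' (Set.univ : Set (BTZ.AdS k))) = Set.univ) :
    BTZ.oneParam X • (BTZ.incl k '' BTZ.Singularity k) = BTZ.Singularity (k + 1) ∧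
    BTZ.oneParam X • (BTZ.incl k '' BTZ.FreePart k) = BTZ.FreePart (k + 1) ∧
    BTZ.oneParam X • (BTZ.incl k '' BTZ.BlackHole k) = BTZ.BlackHole (k + 1) ∧
    BTZ.oneParam X • (BTZ.incl k '' BTZ.Horizon k) = BTZ.Horizon (k + 1) := by
  have hS : ∀ r ∈ BTZ.oneParam X, ∀ p : BTZ.AdS (k + 1),
      r • p ∈ BTZ.Singularity (k + 1) ↔ p ∈ BTZ.Singularity (k + 1) := fun r hr =>
    BTZ.smul_mem_Singularity_iff (BTZ.oneParam_mem_lineStabilizer hX hr (by norm_num))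
      (BTZ.oneParam_mem_lineStabilizer hX hr (by norm_num))
  have hBH : ∀ r ∈ BTZ.oneParam X, ∀ p : BTZ.AdS (k + 1),
      r • p ∈ BTZ.BlackHole (k + 1) ↔ p ∈ BTZ.BlackHole (k + 1) := fun r hr =>
    BTZ.smul_mem_BlackHole_iff (hS r hr)
  refine ⟨BTZ.oneParam_smul_image_incl hR hS BTZ.incl_mem_Singularity_iff,
    BTZ.oneParam_smul_image_incl hR (fun r hr p => ?_) BTZ.incl_mem_FreePart_iff,
    BTZ.oneParam_smul_image_incl hR hBH BTZ.incl_mem_BlackHole_iff,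
    BTZ.oneParam_smul_image_incl hR (fun r hr => BTZ.smul_mem_Horizon_iff (hBH r hr))
      BTZ.incl_mem_Horizon_iff⟩
  rw [BTZ.FreePart_eq_compl, Set.mem_compl_iff, Set.mem_compl_iff, hBH r hr]
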